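/- Let $R=\bigoplus_{n\in\mathbb Z}R_n$ be a commutative Noetherian $\mathbb Z$-graded ring which is $H$-local, i.e. $R$ has exactly one ideal $P$ that is maximal among the proper graded ideals of $R$ (the $H$-maximal ideal, which is prime but need not be a maximal ideal), and let $M\neq(0)$ be a finitely generated graded $R$-module. For a Noetherian ring $A$ and a finitely generated $A$-module $N \ne (0)$ put $\mathcal S(N)=\{\dim_A L\mid (0)\ne L\subseteq N \text{ an } A\text{-submodule}\}=\{d_1<d_2<\dots<d_\ell\}$. The dimension filtration of $N$ is the chain $(0)=D_0\subsetneq D_1\subsetneq\dots\subsetneq D_\ell=N$, where, for $1\le i\le \ell$, $D_i$ is the largest $A$-submodule of $N$ with $\dim_A D_i\le d_i$. The module $N$ is called sequentially Cohen-Macaulay if $D_i/D_{i-1}$ is a Cohen-Macaulay $A$-module for every $1\le i\le\ell$; here a finitely generated $A$-module $C$ is Cohen-Macaulay if $\operatorname{depth}_{A_{\mathfrak m}}C_{\mathfrak m}=\dim_{A_{\mathfrak m}}C_{\mathfrak m}$ for every maximal ideal $\mathfrak m\in\operatorname{Supp}_A C$. Then the following conditions are equivalent: (1) $M$ is a sequentially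 Cohen-Macaulay $R$-module; (2) $M_P$ is a sequentially Cohen-Macaulay $R_P$-module. When this is the case, $M_{\mathfrak p}$ is a sequentially Cohen-Macaulay $R_{\mathfrak p}$-module for every $\mathfrak p\in\operatorname{Supp}_R M$. -/

import Mathlib

noncomputable section

/-! ### H-local rings -/

section HLocal

variable {R : Type*} [CommRing R] (𝒜 : ℤ → AddSubgroup R) [GradedRing 𝒜]

/-- An H-maximal ideal of a `ℤ`-graded ring: a proper graded ideal which is maximal among the
proper graded ideals (it need not be a maximal ideal). -/
def IsHMaximal (P : Ideal R) : Prop :=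
  P.IsHomogeneous 𝒜 ∧ P ≠ ⊤ ∧ ∀ J : Ideal R, J.IsHomogeneous 𝒜 → P < J → J = ⊤

/-- A `ℤ`-graded ring is H-local if it has exactly one H-maximal ideal. -/
class IsHLocalRing : Prop where
  existsUnique_isHMaximal : ∃! P : Ideal R, IsHMaximal 𝒜 P

/-- The unique H-maximal ideal of an H-local ring. -/
def hMaximalIdeal [IsHLocalRing 𝒜] : Ideal R :=
  (IsHLocalRing.existsUnique_isHMaximal (𝒜 := 𝒜)).choose

theorem hMaximalIdeal_isHMaximal [IsHLocalRing 𝒜] : IsHMaximal 𝒜 (hMaximalIdeal 𝒜) :=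
  (IsHLocalRing.existsUnique_isHMaximal (𝒜 := 𝒜)).choose_spec.1

variable {𝒜} in
theorem IsHMaximal.isPrime {P : Ideal R} (hP : IsHMaximal 𝒜 P) : P.IsPrime := by
  obtain ⟨hh, hne, hmax⟩ := hP
  refine hh.isPrime_of_homogeneous_mem_or_mem hne fun {x y} hx _ hxy => ?_
  by_contra! hcon
  obtain ⟨hxP, hyP⟩ := hcon
  have hsp : (Ideal.span {x}).IsHomogeneous 𝒜 :=
    Ideal.homogeneous_span 𝒜 {x} (by rintro z rfl; exact hx)
  have htop : P ⊔ Ideal.span {x} = ⊤ := by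
    refine hmax _ (hh.sup hsp) (lt_of_le_of_ne le_sup_left fun h => hxP ?_)
    rw [h]
    exact Ideal.mem_sup_right (Ideal.mem_span_singleton_self x)
  have h1 : (1 : R) ∈ P ⊔ Ideal.span {x} := htop ▸ Submodule.mem_top
  obtain ⟨p, hp, z, hz, hpz⟩ := Submodule.mem_sup.mp h1
  obtain ⟨a, rfl⟩ := Ideal.mem_span_singleton.mp hz
  refine hyP ?_
  have hy : y = y * p + a * (x * y) := by linear_combination (-y) * hpz
  rw [hy]
  exact P.add_mem (P.mul_mem_left _ hp) (P.mul_mem_left _ hxy)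

instance hMaximalIdeal_isPrime [IsHLocalRing 𝒜] : (hMaximalIdeal 𝒜).IsPrime :=
  (hMaximalIdeal_isHMaximal 𝒜).isPrime

end HLocal

/-! ### Cohen-Macaulay modules -/

section CohenMacaulay

/-- The depth of a module over a local ring: the supremum of the lengths of the `M`-regular
sequences contained in the maximal ideal. -/
def localDepth (R : Type*) [CommRing R] [IsLocalRing R]
    (M : Type*) [AddCommGroup M] [Module R M] : ℕ∞ :=
  ⨆ rs : {rs : List R // (∀ r ∈ rs, r ∈ IsLocalRing.maximalIdeal R) ∧
    RingTheory.Sequence.IsRegular M rs}, (rs.1.length : ℕ∞)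

/-- A finitely generated module `M` over a Noetherian ring `R` is Cohen-Macaulay if
`depth M_𝔪 = dim M_𝔪` over `R_𝔪` for every maximal ideal `𝔪` in the support of `M`. -/
def IsCohenMacaulayModule (R : Type*) [CommRing R]
    (M : Type*) [AddCommGroup M] [Module R M] : Prop :=
  ∀ m ∈ Module.support R M, m.asIdeal.IsMaximal →
    (localDepth (Localization.AtPrime m.asIdeal)
        (LocalizedModule m.asIdeal.primeCompl M) : WithBot ℕ∞) =
      Module.supportDim (Localization.AtPrime m.asIdeal)
        (LocalizedModule m.asIdeal.primeCompl M)

end CohenMacaulay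

/-! ### The dimension filtration and sequentially Cohen-Macaulay modules -/

section DimensionFiltration

variable (R : Type*) [CommRing R] (M : Type*) [AddCommGroup M] [Module R M]

/-- The set `𝒮(M)` of the dimensions of the nonzero submodules of `M`. -/
def submoduleDims : Set (WithBot ℕ∞) :=
  {d | ∃ N : Submodule R M, N ≠ ⊥ ∧ Module.supportDim R N = d}

variable {R M} in
/-- `D_0, …, D_ℓ` is the dimension filtration of `M`: writing
`𝒮(M) = {d_1 < ⋯ < d_ℓ}`, one has `D_0 = 0` and, for `1 ≤ i ≤ ℓ`, `D_i` is the largest submodule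
of `M` of dimension at most `d_i`. (The index of `d` is shifted by one: `d i` is `d_{i+1}`.) -/
def IsDimensionFiltration {l : ℕ} (D : Fin (l + 1) → Submodule R M) : Prop :=
  ∃ d : Fin l → WithBot ℕ∞, StrictMono d ∧ Set.range d = submoduleDims R M ∧
    D 0 = ⊥ ∧
    ∀ i : Fin l, IsGreatest {N : Submodule R M | Module.supportDim R N ≤ d i} (D i.succ)

/-- `M` is sequentially Cohen-Macaulay: all the quotients `D_i / D_{i-1}`, `1 ≤ i ≤ ℓ`, of its
dimension filtration (which is unique) are Cohen-Macaulay. -/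
def IsSequentiallyCM : Prop :=
  ∃ (l : ℕ) (D : Fin (l + 1) → Submodule R M), IsDimensionFiltration D ∧
    ∀ i : Fin l, IsCohenMacaulayModule R
      (↥(D i.succ) ⧸ (D i.castSucc).submoduleOf (D i.succ))

end DimensionFiltration

end

universe u v

open Pointwise

/-! ### Relative heights in a preorder -/

section RelHeight

variable {α : Type*} [PartialOrder α]

/-- The supremum of the lengths of the chains contained in the interval `[p, q]`. -/
noncomputable def relHeight (p q : α) : ℕ∞ :=
  ⨆ s : {s : LTSeries α // p ≤ s.head ∧ s.last ≤ q}, (s.1.length : ℕ∞)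

theorem length_le_relHeight {p q : α} {s : LTSeries α} (h₁ : p ≤ s.head) (h₂ : s.last ≤ q) :
    (s.length : ℕ∞) ≤ relHeight p q :=
  le_iSup (fun s : {s : LTSeries α // p ≤ s.head ∧ s.last ≤ q} => (s.1.length : ℕ∞)) ⟨s, h₁, h₂⟩

theorem relHeight_le {p q : α} {n : ℕ∞}
    (h : ∀ s : LTSeries α, p ≤ s.head → s.last ≤ q → (s.length : ℕ∞) ≤ n) : relHeight p q ≤ n :=
  iSup_le fun s => h s.1 s.2.1 s.2.2

/-- The spectrum of R_q is order isomorphic to `Set.Iic q`, so this translates dimensions over R_q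
into chains of primes of R. -/
theorem coheight_Iic_eq_relHeight (q : α) (p : Set.Iic q) :
    Order.coheight p = relHeight p.1 q := by
  apply le_antisymm
  · refine Order.coheight_le_iff.mpr fun s hs => ?_
    exact length_le_relHeight (s := s.map (fun x => x.1) fun _ _ h => h) hs s.last.2
  · refine relHeight_le fun s h₁ h₂ => ?_
    let t : LTSeries (Set.Iic q) :=
      { length := s.length
        toFun := fun i => ⟨s i, (LTSeries.monotone s (Fin.le_last i)).trans h₂⟩
        step := fun i => s.step i }
    exact Order.length_le_coheight (p := t) h₁

theorem exists_series_of_le_relHeight {p q : α} (hpq : p ≤ q) {n : ℕ} (h : n ≤ relHeight p q) :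
    ∃ s : LTSeries α, s.head = p ∧ s.last ≤ q ∧ s.length = n := by
  rw [← coheight_Iic_eq_relHeight q ⟨p, hpq⟩] at h
  obtain ⟨s, hs, hn⟩ := Order.exists_series_of_le_coheight _ h
  refine ⟨s.map (fun x => x.1) fun _ _ h => h, congrArg Subtype.val hs, s.last.2, hn⟩

theorem relHeight_mono {p p' q q' : α} (hp : p' ≤ p) (hq : q ≤ q') :
    relHeight p q ≤ relHeight p' q' :=
  relHeight_le fun _ h₁ h₂ => length_le_relHeight (hp.trans h₁) (h₂.trans hq)

theorem relHeight_le_coheight (p q : α) : relHeight p q ≤ Order.coheight p :=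
  relHeight_le fun _ h₁ _ => Order.length_le_coheight h₁

theorem relHeight_le_height (p q : α) : relHeight p q ≤ Order.height q :=
  relHeight_le fun _ _ h₂ => Order.length_le_height h₂

theorem relHeight_self (p : α) : relHeight p p = 0 := by
  rw [← coheight_Iic_eq_relHeight p ⟨p, le_rfl⟩, Order.coheight_eq_zero]
  exact fun x _ => x.2

theorem relHeight_add_one_le_of_lt_left {p p' q : α} (h : p < p') (hq : p' ≤ q) :
    relHeight p' q + 1 ≤ relHeight p q := by
  rw [← coheight_Iic_eq_relHeight q ⟨p', hq⟩, ← coheight_Iic_eq_relHeight q ⟨p, h.le.trans hq⟩]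
  exact Order.coheight_add_one_le (show (⟨p, _⟩ : Set.Iic q) < ⟨p', hq⟩ from h)

theorem relHeight_add_le {p q r : α} (hpq : p ≤ q) (hqr : q ≤ r) :
    relHeight p q + relHeight q r ≤ relHeight p r := by
  -- Either term may be `⊤`, so the sum is tested against natural numbers, each split into lengths
  -- realised by actual chains.
  refine (ENat.forall_natCast_le_iff_le).mp fun n hn => ?_
  obtain ⟨a, b, ha, hb, rfl⟩ : ∃ a b : ℕ, (a : ℕ∞) ≤ relHeight p q ∧ (b : ℕ∞) ≤ relHeight q r ∧
      n = a + b := by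
    by_cases h : (n : ℕ∞) ≤ relHeight p q
    · exact ⟨n, 0, h, by simp, by simp⟩
    · obtain ⟨a, ha⟩ := ENat.ne_top_iff_exists.mp (lt_top_of_lt (not_le.mp h)).ne
      rw [← ha] at h hn ⊢
      have hlt : a < n := by exact_mod_cast not_le.mp h
      refine ⟨a, n - a, le_rfl, ?_, by omega⟩
      by_cases hb : relHeight q r = ⊤
      · simp [hb]
      · obtain ⟨b, hb⟩ := ENat.ne_top_iff_exists.mp hb
        rw [← hb] at hn ⊢
        norm_cast at hn ⊢
        omega
  obtain ⟨s, hs₁, hs₂, rfl⟩ := exists_series_of_le_relHeight hpq ha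
  obtain ⟨t, ht₁, ht₂, rfl⟩ := exists_series_of_le_relHeight hqr hb
  -- The first chain may stop strictly below q; it is then concatenated with the second, otherwise
  -- the two are glued at q.
  rcases hs₂.lt_or_eq with hlt | heq
  · have := length_le_relHeight (p := p) (q := r) (s := s.append t (by rw [ht₁]; exact hlt))
      (by simp [hs₁]) (by simpa using ht₂)
    refine le_trans ?_ this
    simp only [RelSeries.append_length]
    norm_cast
    omega
  · have := length_le_relHeight (p := p) (q := r) (s := s.smash t (by rw [ht₁, heq]))
      (by simp [hs₁]) (by simpa using ht₂)
    refine le_trans ?_ this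
    simp

theorem relHeight_add_one_le_of_lt_right {p q r : α} (hpq : p ≤ q) (hqr : q < r) :
    relHeight p q + 1 ≤ relHeight p r := by
  refine le_trans ?_ (relHeight_add_le hpq hqr.le)
  gcongr
  simpa [relHeight_self] using relHeight_add_one_le_of_lt_left hqr le_rfl

theorem relHeight_add_coheight_le {p q : α} (hpq : p ≤ q) :
    relHeight p q + Order.coheight q ≤ Order.coheight p := by
  refine (ENat.forall_natCast_le_iff_le).mp fun n hn => ?_
  obtain ⟨b, hb, hn⟩ : ∃ b : ℕ, (b : ℕ∞) ≤ Order.coheight q ∧ (n : ℕ∞) ≤ relHeight p q + b := by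
    by_cases h : (n : ℕ∞) ≤ Order.coheight q
    · exact ⟨n, h, le_add_self⟩
    · obtain ⟨a, ha⟩ := ENat.ne_top_iff_exists.mp (lt_top_of_lt (not_le.mp h)).ne
      exact ⟨a, ha.le, by rwa [ha]⟩
  obtain ⟨t, ht₁, rfl⟩ := Order.exists_series_of_le_coheight _ hb
  have h1 : (t.length : ℕ∞) ≤ relHeight q t.last := length_le_relHeight ht₁.ge le_rfl
  have hq : q ≤ t.last := ht₁ ▸ LTSeries.monotone t (Fin.zero_le _)
  exact hn.trans <| (add_le_add_right h1 _).trans <| (relHeight_add_le hpq hq).trans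
    (relHeight_le_coheight _ _)

end RelHeight

section PrimeSpectrum

variable {R : Type*} [CommRing R]

theorem relHeight_ne_top [IsNoetherianRing R] (p q : PrimeSpectrum R) : relHeight p q ≠ ⊤ := by
  refine ne_top_of_le_ne_top ?_ (relHeight_le_height p q)
  have := Ideal.height_ne_top (I := q.asIdeal) q.2.ne_top
  rwa [PrimeSpectrum.height_eq_orderHeight] at this

end PrimeSpectrum

/-! ### Associated primes and supports -/

section Basic

variable {R : Type*} [CommRing R] [IsNoetherianRing R]
  {M : Type*} [AddCommGroup M] [Module R M]

theorem mem_associatedPrimes_iff {p : Ideal R} :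
    p ∈ associatedPrimes R M ↔ p.IsPrime ∧ ∃ x : M, ∀ r, r ∈ p ↔ r • x = 0 := by
  rw [AssociatedPrimes.mem_iff, isAssociatedPrime_iff]
  refine and_congr_right fun _ => exists_congr fun x => ?_
  rw [SetLike.ext_iff]
  simp only [Submodule.mem_colon_singleton, Submodule.mem_bot]

theorem mem_support_of_mem_associatedPrimes {p : PrimeSpectrum R}
    (hp : p.asIdeal ∈ associatedPrimes R M) : p ∈ Module.support R M := by
  obtain ⟨-, x, hx⟩ := mem_associatedPrimes_iff.mp hp
  exact Module.mem_support_iff'.mpr ⟨x, fun r hr h => hr ((hx r).mpr h)⟩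

theorem exists_associatedPrime_le_of_mem_support [Module.Finite R M] {q : PrimeSpectrum R}
    (hq : q ∈ Module.support R M) :
    ∃ p : PrimeSpectrum R, p.asIdeal ∈ associatedPrimes R M ∧ p ≤ q := by
  obtain ⟨p, hp, hpq⟩ := Ideal.exists_minimalPrimes_le (Module.annihilator_le_of_mem_support hq)
  exact ⟨⟨p, hp.1.1⟩, Module.associatedPrimes.minimalPrimes_annihilator_subset_associatedPrimes R M hp,
    hpq⟩

-- The support is closed under specialization, so a chain of primes starting in it stays in it.
-- Strict bounds by naturals cover the zero module, of dimension `⊥`, without a case distinction.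
omit [IsNoetherianRing R] in
theorem supportDim_lt_iff {n : ℕ} :
    Module.supportDim R M < n ↔ ∀ p ∈ Module.support R M, Order.coheight p < n := by
  rw [Module.supportDim, Order.krullDim_lt_coe_iff]
  constructor
  · intro h p hp
    by_contra! hn
    obtain ⟨s, hs, hsn⟩ := Order.exists_series_of_le_coheight _ hn
    let t : LTSeries (Module.support R M) :=
      { length := s.length
        toFun := fun i => ⟨s i, Module.mem_support_mono
          (hs ▸ LTSeries.monotone s (Fin.zero_le i)) hp⟩
        step := fun i => s.step i }
    exact (h t).ne hsn
  · intro h s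
    have := (Order.length_le_coheight (p := s.map (fun x => x.1) fun _ _ h => h) le_rfl).trans_lt
      (h _ s.head.2)
    exact_mod_cast this

theorem supportDim_lt_iff_associatedPrimes [Module.Finite R M] {n : ℕ} :
    Module.supportDim R M < n ↔
      ∀ p : PrimeSpectrum R, p.asIdeal ∈ associatedPrimes R M → Order.coheight p < n := by
  rw [supportDim_lt_iff]
  refine ⟨fun h p hp => h p (mem_support_of_mem_associatedPrimes hp), fun h q hq => ?_⟩
  obtain ⟨p, hp, hpq⟩ := exists_associatedPrime_le_of_mem_support hq
  exact (Order.coheight_anti hpq).trans_lt (h p hp)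

theorem isSMulRegular_iff_forall_associatedPrimes {x : R} :
    IsSMulRegular M x ↔ ∀ p ∈ associatedPrimes R M, x ∉ p := by
  have := congrArg (x ∈ ·) (biUnion_associatedPrimes_eq_compl_regular R M)
  simp only [Set.mem_iUnion, SetLike.mem_coe, Set.mem_compl_iff, Set.mem_ofPred_eq, eq_iff_iff] at this
  rw [← not_iff_not, ← this]
  simp

end Basic

/-! ### Localization at a prime -/

section Localization

variable {R : Type*} [CommRing R] (q : PrimeSpectrum R)
  {A : Type*} [CommRing A] [Algebra R A] [IsLocalization.AtPrime A q.asIdeal]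
  {M : Type*} [AddCommGroup M] [Module R M] {M' : Type*} [AddCommGroup M'] [Module R M']
  (f : M →ₗ[R] M') [IsLocalizedModule q.asIdeal.primeCompl f] [Module A M'] [IsScalarTower R A M']

include q in
theorem comap_le_of_isLocalization_atPrime (p : PrimeSpectrum A) :
    PrimeSpectrum.comap (algebraMap R A) p ≤ q :=
  (IsLocalization.AtPrime.primeSpectrumOrderIso A q.asIdeal p).2

theorem exists_comap_eq_of_le {p : PrimeSpectrum R} (hp : p ≤ q) :
    ∃ p' : PrimeSpectrum A, PrimeSpectrum.comap (algebraMap R A) p' = p := by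
  obtain ⟨p', hp'⟩ := (IsLocalization.AtPrime.primeSpectrumOrderIso A q.asIdeal).surjective ⟨p, hp⟩
  exact ⟨p', congrArg Subtype.val hp'⟩

theorem coheight_eq_relHeight_comap (p : PrimeSpectrum A) :
    Order.coheight p = relHeight (PrimeSpectrum.comap (algebraMap R A) p) q := by
  rw [← Order.coheight_orderIso (IsLocalization.AtPrime.primeSpectrumOrderIso A q.asIdeal) p,
    coheight_Iic_eq_relHeight]
  rfl

include q f in
theorem mem_support_iff_comap_mem_support (p : PrimeSpectrum A) :
    p ∈ Module.support A M' ↔ PrimeSpectrum.comap (algebraMap R A) p ∈ Module.support R M := by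
  have hle := comap_le_of_isLocalization_atPrime q p
  rw [Module.mem_support_iff', Module.mem_support_iff']
  constructor
  · rintro ⟨m', hm'⟩
    obtain ⟨⟨m, s⟩, rfl⟩ := IsLocalizedModule.mk'_surjective q.asIdeal.primeCompl f m'
    refine ⟨m, fun r hr h => hm' (algebraMap R A r) hr ?_⟩
    rw [Function.uncurry_apply_pair, algebraMap_smul, ← IsLocalizedModule.mk'_smul, h,
      IsLocalizedModule.mk'_zero]
  · rintro ⟨m, hm⟩
    refine ⟨f m, fun a ha h => ?_⟩
    obtain ⟨r, s, rfl⟩ := IsLocalization.exists_mk'_eq q.asIdeal.primeCompl a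
    have h1 : f (r • m) = 0 := by
      have := congrArg (fun x => algebraMap R A s • x) h
      simpa [← mul_smul, algebraMap_smul] using this
    obtain ⟨c, hc⟩ := (IsLocalizedModule.eq_zero_iff q.asIdeal.primeCompl f).mp h1
    refine hm (c * r) (fun hcr => ?_) (by rw [mul_smul]; exact hc)
    rcases (PrimeSpectrum.comap (algebraMap R A) p).2.mem_or_mem hcr with h | h
    · exact c.2 (hle h)
    · apply ha
      rw [IsLocalization.mk'_eq_mul_mk'_one]
      exact p.asIdeal.mul_mem_right _ h

include q f in
theorem nontrivial_iff_mem_support_of_isLocalizedModule :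
    Nontrivial M' ↔ q ∈ Module.support R M := by
  rw [Module.mem_support_iff]
  exact (IsLocalizedModule.linearEquiv q.asIdeal.primeCompl f
    (LocalizedModule.mkLinearMap q.asIdeal.primeCompl M)).toEquiv.nontrivial_congr

include q f in
theorem mem_associatedPrimes_iff_comap [IsNoetherianRing R] (p : PrimeSpectrum A) :
    p.asIdeal ∈ associatedPrimes A M' ↔
      (PrimeSpectrum.comap (algebraMap R A) p).asIdeal ∈ associatedPrimes R M := by
  rw [← Module.associatedPrimes.preimage_comap_associatedPrimes_eq_associatedPrimes_of_isLocalizedModule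
    q.asIdeal.primeCompl A f]
  rfl

include q f in
theorem isSMulRegular_atPrime_iff [IsNoetherianRing R] (x : R) :
    IsSMulRegular M' (algebraMap R A x) ↔
      ∀ p ∈ associatedPrimes R M, p ≤ q.asIdeal → x ∉ p := by
  have : IsNoetherianRing A := IsLocalization.isNoetherianRing q.asIdeal.primeCompl A inferInstance
  rw [isSMulRegular_iff_forall_associatedPrimes]
  constructor
  · intro h p hp hpq hx
    obtain ⟨p', hp'⟩ := exists_comap_eq_of_le (A := A) q (p := ⟨p, hp.isPrime⟩) hpq
    refine h p'.asIdeal ((mem_associatedPrimes_iff_comap q f p').mpr (hp' ▸ hp)) ?_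
    change x ∈ (PrimeSpectrum.comap (algebraMap R A) p').asIdeal
    rwa [hp']
  · intro h p hp hx
    let p' : PrimeSpectrum A := ⟨p, hp.isPrime⟩
    exact h _ ((mem_associatedPrimes_iff_comap q f p').mp hp)
      (comap_le_of_isLocalization_atPrime q p') hx

/-- Identifies M'/rM' with the localization of M/xM; the unit factor is what clearing the
denominator of r leaves behind. -/
theorem localized'_smul_top (x : R) (r : A) (u : Aˣ) (hr : r = u * algebraMap R A x) :
    r • (⊤ : Submodule A M') =
      (x • (⊤ : Submodule R M)).localized' A q.asIdeal.primeCompl f := by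
  have hu : r • (⊤ : Submodule A M') = algebraMap R A x • (⊤ : Submodule A M') := by
    rw [← Submodule.ideal_span_singleton_smul, ← Submodule.ideal_span_singleton_smul, hr,
      Ideal.span_singleton_mul_left_unit u.isUnit]
  rw [hu, ← Submodule.ideal_span_singleton_smul, ← Submodule.ideal_span_singleton_smul,
    Submodule.localized'_smul, Ideal.localized'_eq_map, Submodule.localized'_top, Ideal.map_span,
    Set.image_singleton]

end Localization

/-! ### Depth at a prime -/

section Depth

variable {R : Type*} [CommRing R]

/-- The localization of `M` at `q` has a regular sequence of length `n` in the maximal ideal.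
This is phrased over the base ring: an element of `q` is regular on `M_q` if and only if it avoids
the associated primes of `M` contained in `q`. -/
def HasDepthAt (q : PrimeSpectrum R) :
    ℕ → ∀ (M : Type*) [AddCommGroup M] [Module R M], Prop
  | 0, M, _, _ => q ∈ Module.support R M
  | n + 1, M, _, _ => ∃ x ∈ q.asIdeal, (∀ p ∈ associatedPrimes R M, p ≤ q.asIdeal → x ∉ p) ∧
      HasDepthAt q n (QuotSMulTop x M)

/-- Every element of the maximal ideal of R_q is a unit times the image of an element of q, and
localization commutes with M ↦ M/xM. A regular sequence can therefore be replaced by elements of R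
one at a time. -/
theorem hasDepthAt_iff_exists_isRegular [IsNoetherianRing R] (q : PrimeSpectrum R)
    {A : Type*} [CommRing A] [IsLocalRing A] [Algebra R A] [IsLocalization.AtPrime A q.asIdeal]
    (n : ℕ) {M : Type*} [AddCommGroup M] [Module R M] {M' : Type*} [AddCommGroup M'] [Module R M']
    (f : M →ₗ[R] M') [IsLocalizedModule q.asIdeal.primeCompl f] [Module A M']
    [IsScalarTower R A M'] :
    HasDepthAt q n M ↔ ∃ rs : List A, rs.length = n ∧
      (∀ r ∈ rs, r ∈ IsLocalRing.maximalIdeal A) ∧ RingTheory.Sequence.IsRegular M' rs := by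
  induction n generalizing M M' with
  | zero =>
    rw [HasDepthAt, ← nontrivial_iff_mem_support_of_isLocalizedModule q f]
    constructor
    · intro h
      exact ⟨[], rfl, by simp, RingTheory.Sequence.IsRegular.nil A M'⟩
    · rintro ⟨rs, -, -, h⟩
      exact h.nontrivial
  | succ n ih =>
    have key : ∀ (x : R) (r : A) (u : Aˣ) (_ : r = u * algebraMap R A x),
        HasDepthAt q n (QuotSMulTop x M) ↔ ∃ rs : List A, rs.length = n ∧
          (∀ r ∈ rs, r ∈ IsLocalRing.maximalIdeal A) ∧
          RingTheory.Sequence.IsRegular (QuotSMulTop r M') rs := by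
      intro x r u hr
      rw [ih ((x • (⊤ : Submodule R M)).toLocalizedQuotient' A q.asIdeal.primeCompl f)]
      refine exists_congr fun rs => and_congr_right fun _ => and_congr_right fun _ => ?_
      exact (Submodule.quotEquivOfEq _ _
        (localized'_smul_top q f x r u hr).symm).isRegular_congr rs
    constructor
    · rintro ⟨x, hx, hreg, h⟩
      obtain ⟨rs, hl, hm, hrs⟩ := (key x (algebraMap R A x) 1 (by simp)).mp h
      refine ⟨algebraMap R A x :: rs, by simp [hl], ?_,
        .cons ((isSMulRegular_atPrime_iff q f x).mpr hreg) hrs⟩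
      simp only [List.mem_cons, forall_eq_or_imp]
      exact ⟨(IsLocalization.AtPrime.to_map_mem_maximal_iff A q.asIdeal x).mpr hx, hm⟩
    · rintro ⟨_ | ⟨r, rs⟩, hl, hm, hrs⟩
      · simp at hl
      obtain ⟨x, s, hrx⟩ := IsLocalization.exists_mk'_eq q.asIdeal.primeCompl r
      obtain ⟨u, hu⟩ := (IsLocalization.map_units A s)
      have hr : r = (u⁻¹ : Aˣ) * algebraMap R A x := by
        rw [← hrx, Units.eq_inv_mul_iff_mul_eq, hu, IsLocalization.mk'_spec']
      have hr' : algebraMap R A x = u * r := by rw [hr]; simp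
      simp only [List.mem_cons, forall_eq_or_imp] at hm
      obtain ⟨h1, h2⟩ := (RingTheory.Sequence.isRegular_cons_iff M' r rs).mp hrs
      refine ⟨x, ?_, ?_, ?_⟩
      · rw [← IsLocalization.AtPrime.to_map_mem_maximal_iff A q.asIdeal x, hr']
        exact Ideal.mul_mem_left _ _ hm.1
      · refine (isSMulRegular_atPrime_iff (A := A) q f x).mp ?_
        rw [hr']
        exact (IsUnit.isSMulRegular M' u.isUnit).mul h1
      · exact (key x r u⁻¹ hr).mpr ⟨rs, by simpa using hl, hm.2, h2⟩

end Depth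

/-! ### Regular sequences over a local ring -/

section Local

open CategoryTheory Abelian RingTheory.Sequence

/-- Depth drops by one modulo any regular element, not only the first term of the given sequence.
Depth at least n + 1 is the vanishing of Ext into N in degrees at most n, and the long exact
sequence of 0 → N → N → N/xN → 0 carries this to N/xN in degrees below n. -/
theorem exists_isRegular_quotSMulTop {A : Type u} [CommRing A] [IsLocalRing A] [IsNoetherianRing A]
    {N : Type (max u v)} [AddCommGroup N] [Module A N] [Module.Finite A N] {x : A}
    (hx : x ∈ IsLocalRing.maximalIdeal A) (hreg : IsSMulRegular N x) {n : ℕ}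
    (h : ∃ rs : List A, rs.length = n + 1 ∧ (∀ r ∈ rs, r ∈ IsLocalRing.maximalIdeal A) ∧
      IsRegular N rs) :
    ∃ rs : List A, rs.length = n ∧ (∀ r ∈ rs, r ∈ IsLocalRing.maximalIdeal A) ∧
      IsRegular (QuotSMulTop x N) rs := by
  have : Small.{max u v} A := small_lift.{u, max u v} A
  have hN : Nontrivial N := h.choose_spec.2.2.nontrivial
  have hQ : Nontrivial (QuotSMulTop x N) := nontrivial_quotSMulTop_of_mem_maximalIdeal N hx
  have hlt : ∀ (L : Type (max u v)) [AddCommGroup L] [Module A L] [Module.Finite A L]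
      [Nontrivial L], IsLocalRing.maximalIdeal A • (⊤ : Submodule A L) < ⊤ := by
    intro L _ _ _ _
    exact (Submodule.top_ne_ideal_smul_of_le_jacobson_annihilator
      (IsLocalRing.maximalIdeal_le_jacobson _)).symm.lt_top
  have t1 := ModuleCat.exists_isRegular_tfae (IsLocalRing.maximalIdeal A) (n + 1)
    (ModuleCat.of A N) (hlt N)
  have t2 := ModuleCat.exists_isRegular_tfae (IsLocalRing.maximalIdeal A) n
    (ModuleCat.of A (QuotSMulTop x N)) (hlt (QuotSMulTop x N))
  have e1 := (t1.out 3 1).mp h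
  refine (t2.out 1 3).mp fun i hi => ?_
  have zero1 := AddCommGrpCat.isZero_of_iff_subsingleton.mpr (e1 i (by omega))
  have zero2 := AddCommGrpCat.isZero_of_iff_subsingleton.mpr (e1 (i + 1) (by omega))
  have hreg' : IsSMulRegular (ModuleCat.of A N) x := hreg
  exact AddCommGrpCat.subsingleton_of_isZero <| ShortComplex.Exact.isZero_of_both_zeros
    ((Ext.covariant_sequence_exact₃' _ hreg'.smulShortComplex_shortExact) i (i + 1) rfl)
    (zero1.eq_zero_of_src _) (zero2.eq_zero_of_tgt _)

theorem exists_associatedPrime_quotSMulTop_gt {A : Type*} [CommRing A] [IsLocalRing A]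
    [IsNoetherianRing A] {N : Type*} [AddCommGroup N] [Module A N] [Module.Finite A N] {x : A}
    (hx : x ∈ IsLocalRing.maximalIdeal A) (hreg : IsSMulRegular N x)
    {p : Ideal A} (hp : p ∈ associatedPrimes A N) :
    ∃ p' ∈ associatedPrimes A (QuotSMulTop x N), p < p' := by
  have hxp : x ∉ p := isSMulRegular_iff_forall_associatedPrimes.mp hreg p hp
  obtain ⟨-, y, hy⟩ := mem_associatedPrimes_iff.mp hp
  let K : Submodule A N :=
    { carrier := {z | ∀ a ∈ p, a • z = 0}
      zero_mem' := fun a _ => smul_zero a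
      add_mem' := fun hz hw a ha => by rw [smul_add, hz a ha, hw a ha, add_zero]
      smul_mem' := fun c z hz a ha => by rw [smul_comm, hz a ha, smul_zero] }
  have hyK : y ∈ K := fun a ha => (hy a).mp ha
  have hy0 : y ≠ 0 := fun h => hp.isPrime.ne_top
    ((Ideal.eq_top_iff_one _).mpr ((hy 1).mpr (by simp [h])))
  -- K, the part of N killed by p, is not inside xN: if z = xw is in K, regularity of x puts w in K,
  -- so K ⊆ 𝔪K and K = 0 by Nakayama. An element of K outside xN has a nonzero class killed by p and
  -- by x ∉ p.
  obtain ⟨z, hzK, hz⟩ : ∃ z ∈ K, z ∉ x • (⊤ : Submodule A N) := by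
    by_contra! hcon
    refine hy0 ?_
    have hle : K ≤ IsLocalRing.maximalIdeal A • K := by
      intro z hz
      obtain ⟨w, -, rfl⟩ := (Submodule.mem_smul_pointwise_iff_exists z x ⊤).mp (hcon z hz)
      refine Submodule.smul_mem_smul hx fun a ha => ?_
      have := hz a ha
      rw [smul_comm] at this
      exact hreg.right_eq_zero_of_smul this
    have hbot := Submodule.eq_bot_of_le_smul_of_le_jacobson_bot _ K (IsNoetherian.noetherian K) hle
      (IsLocalRing.maximalIdeal_le_jacobson _)
    rw [hbot] at hyK
    exact hyK
  have hz' : (Submodule.Quotient.mk z : QuotSMulTop x N) ≠ 0 := by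
    rwa [Ne, Submodule.Quotient.mk_eq_zero]
  obtain ⟨p', hp', hle⟩ := exists_le_isAssociatedPrime_of_isNoetherianRing A _ hz'
  have hmem : ∀ a, a • z ∈ x • (⊤ : Submodule A N) → a ∈ p' := fun a ha => hle <| by
    rw [Submodule.mem_colon_singleton, ← Submodule.Quotient.mk_smul]
    exact (Submodule.Quotient.mk_eq_zero _).mpr ha
  refine ⟨p', hp', lt_of_le_of_ne (fun a ha => hmem a ?_) fun h => hxp (h ▸ hmem x ?_)⟩
  · rw [hzK a ha]
    exact zero_mem _
  · exact Submodule.smul_mem_pointwise_smul z x ⊤ trivial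

end Local

/-! ### Depth and Cohen-Macaulayness at a prime -/

section CohenMacaulayAt

variable {R : Type u} [CommRing R] [IsNoetherianRing R] {q : PrimeSpectrum R}
  {M : Type v} [AddCommGroup M] [Module R M] [Module.Finite R M]

variable (M) in
/-- `x ∈ q` is a nonzerodivisor on `M_q`. -/
def IsRegularAt (q : PrimeSpectrum R) (x : R) : Prop :=
  x ∈ q.asIdeal ∧ ∀ p ∈ associatedPrimes R M, p ≤ q.asIdeal → x ∉ p

theorem HasDepthAt.quotSMulTop {n : ℕ} (h : HasDepthAt q (n + 1) M) {x : R}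
    (hx : IsRegularAt M q x) : HasDepthAt q n (QuotSMulTop x M) := by
  let f := LocalizedModule.mkLinearMap q.asIdeal.primeCompl M
  let A := Localization.AtPrime q.asIdeal
  rw [hasDepthAt_iff_exists_isRegular (A := A) q _ f] at h
  rw [hasDepthAt_iff_exists_isRegular (A := A) q _
    ((x • (⊤ : Submodule R M)).toLocalizedQuotient' A q.asIdeal.primeCompl f)]
  have hx' : algebraMap R A x ∈ IsLocalRing.maximalIdeal A :=
    (IsLocalization.AtPrime.to_map_mem_maximal_iff A q.asIdeal x).mpr hx.1
  obtain ⟨rs, h1, h2, h3⟩ := exists_isRegular_quotSMulTop.{u, v} hx'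
    ((isSMulRegular_atPrime_iff (A := A) q f x).mpr hx.2) h
  exact ⟨rs, h1, h2, ((Submodule.quotEquivOfEq _ _
        (localized'_smul_top q f x _ 1 (by simp))).isRegular_congr rs).mp h3⟩

theorem IsRegularAt.exists_associatedPrime_gt {x : R} (hx : IsRegularAt M q x)
    {p : PrimeSpectrum R} (hp : p.asIdeal ∈ associatedPrimes R M) (hpq : p ≤ q) :
    ∃ p' : PrimeSpectrum R, p'.asIdeal ∈ associatedPrimes R (QuotSMulTop x M) ∧ p < p' ∧ p' ≤ q := by
  let f := LocalizedModule.mkLinearMap q.asIdeal.primeCompl M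
  let A := Localization.AtPrime q.asIdeal
  have hx' : algebraMap R A x ∈ IsLocalRing.maximalIdeal A :=
    (IsLocalization.AtPrime.to_map_mem_maximal_iff A q.asIdeal x).mpr hx.1
  obtain ⟨P, rfl⟩ := exists_comap_eq_of_le (A := A) q hpq
  obtain ⟨P', hP', hlt⟩ := exists_associatedPrime_quotSMulTop_gt hx'
    ((isSMulRegular_atPrime_iff (A := A) q f x).mpr hx.2)
    ((mem_associatedPrimes_iff_comap q f P).mpr hp)
  rw [LinearEquiv.AssociatedPrimes.eq (Submodule.quotEquivOfEq _ _
    (localized'_smul_top q f x _ 1 (by simp)))] at hP'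
  let P'' : PrimeSpectrum A := ⟨P', hP'.isPrime⟩
  refine ⟨PrimeSpectrum.comap (algebraMap R A) P'', ?_, ?_, comap_le_of_isLocalization_atPrime q P''⟩
  · exact (mem_associatedPrimes_iff_comap q ((x • (⊤ : Submodule R M)).toLocalizedQuotient' A
      q.asIdeal.primeCompl f) P'').mp hP'
  · exact (IsLocalization.AtPrime.primeSpectrumOrderIso A q.asIdeal).strictMono
      (show P < P'' from hlt)

/-- Depth is at most dim R_q/pR_q for every associated prime: each regular element divided out moves
an associated prime strictly up inside q, which builds a chain above p. -/
theorem HasDepthAt.le_relHeight {n : ℕ} (h : HasDepthAt q n M) {p : PrimeSpectrum R}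
    (hp : p.asIdeal ∈ associatedPrimes R M) (hpq : p ≤ q) : n ≤ relHeight p q := by
  induction n generalizing M p with
  | zero => simp
  | succ n ih =>
    obtain ⟨x, hx, hreg, h⟩ := h
    obtain ⟨p', hp', hlt, hle⟩ := IsRegularAt.exists_associatedPrime_gt ⟨hx, hreg⟩ hp hpq
    have := ih h hp' hle
    push_cast
    exact (add_le_add_left this 1).trans (relHeight_add_one_le_of_lt_left hlt hle)

variable (M) in
/-- The localization of `M` at `q` is a Cohen-Macaulay module of dimension `n`. -/
def IsCMAt (q : PrimeSpectrum R) (n : ℕ) : Prop :=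
  HasDepthAt q n M ∧ ∀ p ∈ Module.support R M, p ≤ q → relHeight p q ≤ n

/-- Unmixedness: depth ≤ ht(q/p) ≤ dimension, and the outer terms agree. -/
theorem IsCMAt.relHeight_eq {n : ℕ} (h : IsCMAt M q n) {p : PrimeSpectrum R}
    (hp : p.asIdeal ∈ associatedPrimes R M) (hpq : p ≤ q) : relHeight p q = n :=
  le_antisymm (h.2 p (mem_support_of_mem_associatedPrimes hp) hpq) (h.1.le_relHeight hp hpq)

theorem exists_mem_isRegularAt_of_le {m : PrimeSpectrum R} (hqm : q ≤ m)
    (hq : ∀ p ∈ associatedPrimes R M, p ≤ m.asIdeal → ¬ q.asIdeal ≤ p) :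
    ∃ x ∈ q.asIdeal, IsRegularAt M m x := by
  by_contra! hcon
  have hfin : {p ∈ associatedPrimes R M | p ≤ m.asIdeal}.Finite :=
    (associatedPrimes.finite R M).subset fun _ h => h.1
  have hsub : (q.asIdeal : Set R) ⊆ ⋃ p ∈ {p ∈ associatedPrimes R M | p ≤ m.asIdeal}, p := by
    intro x hx
    have : ¬ ∀ p ∈ associatedPrimes R M, p ≤ m.asIdeal → x ∉ p := fun h => hcon x hx ⟨hqm hx, h⟩
    push Not at this
    obtain ⟨p, hp, hle, hxp⟩ := this
    exact Set.mem_biUnion (show p ∈ {p ∈ associatedPrimes R M | p ≤ m.asIdeal} from ⟨hp, hle⟩) hxp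
  obtain ⟨p, hp, hle⟩ := (Ideal.subset_union_prime_finite hfin (f := id) ⊥ ⊥
    fun p hp _ _ => hp.1.isPrime).mp hsub
  exact hq p hp.1 hp.2 hle

theorem exists_isRegularAt (hq : q.asIdeal ∉ associatedPrimes R M) : ∃ x, IsRegularAt M q x := by
  obtain ⟨x, -, hx⟩ := exists_mem_isRegularAt_of_le (M := M) (le_refl q)
    fun p hp hle hle' => hq (le_antisymm hle' hle ▸ hp)
  exact ⟨x, hx⟩

/-- A Cohen-Macaulay module over a local ring localizes to Cohen-Macaulay modules, and satisfies
`dim M_q + dim R/q = dim M`. -/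
theorem IsCMAt.localize {m : PrimeSpectrum R} {n : ℕ} (h : IsCMAt M m n) (hqm : q ≤ m)
    (hq : q ∈ Module.support R M) : ∃ k : ℕ, IsCMAt M q k ∧ k + relHeight q m = n := by
  induction n generalizing M with
  | zero =>
    have hq0 : relHeight q m = 0 := by simpa using h.2 q hq hqm
    refine ⟨0, ⟨hq, fun p hp hpq => ?_⟩, by simp [hq0]⟩
    exact (relHeight_mono le_rfl hqm).trans (h.2 p hp (hpq.trans hqm))
  | succ n ih =>
    have hfin := relHeight_ne_top q m
    by_cases hass : q.asIdeal ∈ associatedPrimes R M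
    · have hqn := h.relHeight_eq hass hqm
      refine ⟨0, ⟨hq, fun p hp hpq => ?_⟩, by simp [hqn]⟩
      have := (relHeight_add_le hpq hqm).trans (h.2 p hp (hpq.trans hqm))
      have h0 : relHeight p q + relHeight q m ≤ 0 + relHeight q m := by
        rw [zero_add]
        exact this.trans_eq hqn.symm
      simpa using (ENat.add_le_add_iff_right hfin).mp h0
    -- If an associated prime p inside m contained q, it would contain an associated prime p₀ ⊆ q;
    -- unmixedness forces p₀ = p = q, so q would be associated. Prime avoidance then yields x in q
    -- regular at m, and induction applies to M/xM.
    · obtain ⟨x, hxq, hx⟩ := exists_mem_isRegularAt_of_le (M := M) hqm fun p hp hpm hle => by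
        obtain ⟨p₀, hp₀, hp₀q⟩ := exists_associatedPrime_le_of_mem_support hq
        let p' : PrimeSpectrum R := ⟨p, hp.isPrime⟩
        have hle' : q ≤ p' := hle
        rcases (hp₀q.trans hle').lt_or_eq with hlt | heq
        · have h1 := relHeight_add_one_le_of_lt_left hlt (show p' ≤ m from hpm)
          rw [h.relHeight_eq hp₀ (hp₀q.trans hqm),
            h.relHeight_eq (p := p') hp hpm] at h1
          norm_cast at h1
          omega
        · refine hass ?_
          rwa [← le_antisymm hp₀q (heq ▸ hle')]
      have hQ : IsCMAt (QuotSMulTop x M) m n := by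
        refine ⟨h.1.quotSMulTop hx, fun p hp hpm => ?_⟩
        rw [Module.support_quotSMulTop] at hp
        obtain ⟨p₀, hp₀, hp₀p⟩ := exists_associatedPrime_le_of_mem_support hp.1
        have hlt : p₀ < p := lt_of_le_of_ne hp₀p fun heq =>
          hx.2 _ hp₀ (hp₀p.trans hpm) (heq ▸ hp.2 rfl)
        have h1 := relHeight_add_one_le_of_lt_left hlt hpm
        rw [h.relHeight_eq hp₀ (hp₀p.trans hpm)] at h1
        push_cast at h1
        exact (ENat.add_le_add_iff_right (by simp)).mp h1
      obtain ⟨k, hk, hkn⟩ := ih hQ (by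
        rw [Module.support_quotSMulTop]
        exact ⟨hq, by simpa using hxq⟩)
      have hkn' : ((k + 1 : ℕ) : ℕ∞) + relHeight q m = (n + 1 : ℕ) := by
        push_cast
        rw [← hkn]
        ring
      refine ⟨k + 1, ⟨⟨x, hxq, fun p hp hpq => hx.2 p hp (hpq.trans hqm), hk.1⟩,
        fun p hp hpq => ?_⟩, hkn'⟩
      have := (relHeight_add_le hpq hqm).trans (h.2 p hp (hpq.trans hqm))
      rw [← hkn'] at this
      exact (ENat.add_le_add_iff_right hfin).mp this

/-! ### Comparison with depth and dimension over the localized ring. -/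

section Comparison

variable (q) {A : Type*} [CommRing A] [Algebra R A] [IsLocalization.AtPrime A q.asIdeal]
  {M' : Type*} [AddCommGroup M'] [Module R M'] (f : M →ₗ[R] M')
  [IsLocalizedModule q.asIdeal.primeCompl f] [Module A M'] [IsScalarTower R A M']

omit [IsNoetherianRing R] [Module.Finite R M] in
include q f in
theorem supportDim_atPrime_lt_iff {n : ℕ} : Module.supportDim A M' < n ↔
    ∀ p ∈ Module.support R M, p ≤ q → relHeight p q < n := by
  rw [supportDim_lt_iff]
  constructor
  · intro h p hp hpq
    obtain ⟨P, rfl⟩ := exists_comap_eq_of_le (A := A) q hpq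
    rw [← coheight_eq_relHeight_comap]
    exact h P ((mem_support_iff_comap_mem_support q f P).mpr hp)
  · intro h P hP
    rw [coheight_eq_relHeight_comap q]
    exact h _ ((mem_support_iff_comap_mem_support q f P).mp hP)
      (comap_le_of_isLocalization_atPrime q P)

include f in
theorem localDepth_eq_supportDim_iff [IsLocalRing A] (hq : q ∈ Module.support R M) :
    (localDepth A M' : WithBot ℕ∞) = Module.supportDim A M' ↔ ∃ n, IsCMAt M q n := by
  have hnt : Nontrivial M' := (nontrivial_iff_mem_support_of_isLocalizedModule q f).mpr hq
  constructor
  · intro h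
    obtain ⟨d, hd⟩ : ∃ d : ℕ, Module.supportDim A M' = d := by
      obtain ⟨H, hH⟩ := ENat.ne_top_iff_exists.mp
        (Ideal.height_ne_top (I := q.asIdeal) q.2.ne_top)
      rw [PrimeSpectrum.height_eq_orderHeight] at hH
      have hlt : Module.supportDim A M' < (H + 1 : ℕ) :=
        (supportDim_atPrime_lt_iff q f).mpr fun p _ _ => (relHeight_le_height p q).trans_lt <| by
          rw [← hH]; exact_mod_cast Nat.lt_succ_self H
      obtain ⟨e, he⟩ := WithBot.ne_bot_iff_exists.mp (Module.supportDim_ne_bot_of_nontrivial A M')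
      rw [← he] at hlt ⊢
      have hlt' : e < (H + 1 : ℕ) := by exact_mod_cast hlt
      obtain ⟨d, rfl⟩ := ENat.ne_top_iff_exists.mp (lt_top_of_lt hlt').ne
      exact ⟨d, rfl⟩
    rw [hd] at h
    have h' : localDepth A M' = d := by exact_mod_cast h
    refine ⟨d, ?_, fun p hp hpq => ?_⟩
    · rw [hasDepthAt_iff_exists_isRegular (A := A) q d f]
      rcases d with _ | d
      · exact ⟨[], rfl, by simp, RingTheory.Sequence.IsRegular.nil A M'⟩
      · have hlt : (d : ℕ∞) < localDepth A M' := by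
          rw [h']; exact_mod_cast Nat.lt_succ_self d
        obtain ⟨⟨rs, hrs, hreg⟩, hl⟩ := lt_iSup_iff.mp hlt
        refine ⟨rs, le_antisymm ?_ ?_, hrs, hreg⟩
        · have : (rs.length : ℕ∞) ≤ localDepth A M' := le_iSup
            (fun rs : {rs : List A // (∀ r ∈ rs, r ∈ IsLocalRing.maximalIdeal A) ∧
              RingTheory.Sequence.IsRegular M' rs} => (rs.1.length : ℕ∞)) ⟨rs, hrs, hreg⟩
          rw [h'] at this
          exact_mod_cast this
        · have hl' : d < rs.length := by exact_mod_cast hl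
          exact hl'
    · have := (supportDim_atPrime_lt_iff (A := A) q f (n := d + 1)).mp
        (by rw [hd]; exact_mod_cast Nat.lt_succ_self d) p hp hpq
      exact ENat.lt_add_one_iff (by simp) |>.mp (by exact_mod_cast this)
  · rintro ⟨n, hn⟩
    obtain ⟨p, hp, hpq⟩ := exists_associatedPrime_le_of_mem_support hq
    have hpn := hn.relHeight_eq hp hpq
    have h1 : localDepth A M' = n := by
      apply le_antisymm
      · refine iSup_le fun rs => ?_
        rw [← hpn]
        exact ((hasDepthAt_iff_exists_isRegular (A := A) q _ f).mpr
          ⟨rs.1, rfl, rs.2.1, rs.2.2⟩).le_relHeight hp hpq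
      · obtain ⟨rs, rfl, hrs, hreg⟩ := (hasDepthAt_iff_exists_isRegular (A := A) q n f).mp hn.1
        exact le_iSup
            (fun rs : {rs : List A // (∀ r ∈ rs, r ∈ IsLocalRing.maximalIdeal A) ∧
              RingTheory.Sequence.IsRegular M' rs} => (rs.1.length : ℕ∞)) ⟨rs, hrs, hreg⟩
    have h2 : Module.supportDim A M' < (n + 1 : ℕ) :=
      (supportDim_atPrime_lt_iff q f).mpr fun p hp hpq => (hn.2 p hp hpq).trans_lt
        (by exact_mod_cast Nat.lt_succ_self n)
    have h3 : ¬ Module.supportDim A M' < n := fun h => by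
      have := (supportDim_atPrime_lt_iff q f).mp h p (mem_support_of_mem_associatedPrimes hp) hpq
      exact this.ne hpn
    rw [h1]
    obtain ⟨e, he⟩ := WithBot.ne_bot_iff_exists.mp (Module.supportDim_ne_bot_of_nontrivial A M')
    rw [← he] at h2 h3 ⊢
    have h2' : e < (n + 1 : ℕ) := by exact_mod_cast h2
    have h3' : ¬ e < n := by exact_mod_cast h3
    have h2'' : e ≤ n := ENat.lt_add_one_iff (by simp) |>.mp (by exact_mod_cast h2')
    exact congrArg _ (le_antisymm (not_lt.mp h3') h2'')

end Comparison

theorem isCohenMacaulayModule_iff : IsCohenMacaulayModule R M ↔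
    ∀ m ∈ Module.support R M, m.asIdeal.IsMaximal → ∃ n, IsCMAt M m n := by
  refine forall_congr' fun m => forall_congr' fun hm => forall_congr' fun _ => ?_
  exact localDepth_eq_supportDim_iff m (LocalizedModule.mkLinearMap m.asIdeal.primeCompl M) hm

theorem IsCohenMacaulayModule.exists_isCMAt (h : IsCohenMacaulayModule R M)
    (hq : q ∈ Module.support R M) : ∃ n, IsCMAt M q n := by
  obtain ⟨m, hm, hle⟩ := Ideal.exists_le_maximal q.asIdeal q.2.ne_top
  have hqm : q ≤ ⟨m, hm.isPrime⟩ := hle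
  obtain ⟨n, hn⟩ := isCohenMacaulayModule_iff.mp h ⟨m, hm.isPrime⟩
    (Module.mem_support_mono hqm hq) hm
  obtain ⟨k, hk, -⟩ := hn.localize hqm hq
  exact ⟨k, hk⟩

/-- Cohen-Macaulayness over the localization of `R` at `q`, in terms of `R`. -/
theorem isCohenMacaulayModule_atPrime_iff (q : PrimeSpectrum R) {A : Type*} [CommRing A]
    [Algebra R A] [IsLocalization.AtPrime A q.asIdeal]
    {M' : Type*} [AddCommGroup M'] [Module R M'] (f : M →ₗ[R] M')
    [IsLocalizedModule q.asIdeal.primeCompl f] [Module A M'] [IsScalarTower R A M'] :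
    IsCohenMacaulayModule A M' ↔ (q ∈ Module.support R M → ∃ n, IsCMAt M q n) := by
  have : IsLocalRing A := IsLocalization.AtPrime.isLocalRing A q.asIdeal
  have hc : PrimeSpectrum.comap (algebraMap R A) (IsLocalRing.closedPoint A) = q :=
    PrimeSpectrum.ext (IsLocalization.AtPrime.under_maximalIdeal A q.asIdeal)
  have hs := mem_support_iff_comap_mem_support q f (IsLocalRing.closedPoint A)
  rw [hc] at hs
  have hNA : IsNoetherianRing A :=
    IsLocalization.isNoetherianRing q.asIdeal.primeCompl A inferInstance
  -- The definition localizes A once more at its maximal ideal. A is itself a model of that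
  -- localization, so the criterion is applied to both models over A, and then to A over R.
  have key : ∀ m : PrimeSpectrum A, m = IsLocalRing.closedPoint A → m ∈ Module.support A M' →
      ((localDepth (Localization.AtPrime m.asIdeal)
        (LocalizedModule m.asIdeal.primeCompl M') : WithBot ℕ∞) =
      Module.supportDim (Localization.AtPrime m.asIdeal)
        (LocalizedModule m.asIdeal.primeCompl M') ↔ ∃ n, IsCMAt M q n) := by
    rintro m rfl hm
    have hu : ∀ x ∈ (IsLocalRing.closedPoint A).asIdeal.primeCompl, IsUnit x := fun x hx => by
      by_contra h
      exact hx ((IsLocalRing.mem_maximalIdeal x).mpr h)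
    have hA : IsLocalization.AtPrime A (IsLocalRing.closedPoint A).asIdeal :=
      IsLocalization.of_le_isUnit hu
    have hid : IsLocalizedModule (IsLocalRing.closedPoint A).asIdeal.primeCompl
        (LinearMap.id : M' →ₗ[A] M') := 
      isLocalizedModule_id _ M' A
    have hfin : Module.Finite A M' :=
      Module.Finite.of_isLocalizedModule q.asIdeal.primeCompl f
    rw [localDepth_eq_supportDim_iff (IsLocalRing.closedPoint A)
      (LocalizedModule.mkLinearMap (IsLocalRing.closedPoint A).asIdeal.primeCompl M') hm,
      ← localDepth_eq_supportDim_iff (A := A) (IsLocalRing.closedPoint A)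
        (LinearMap.id : M' →ₗ[A] M') hm, localDepth_eq_supportDim_iff q f (hs.mp hm)]
  constructor
  · intro h hq
    exact (key _ rfl (hs.mpr hq)).mp (h _ (hs.mpr hq) (IsLocalRing.maximalIdeal.isMaximal A))
  · intro h m hm hmax
    have hmc : m = IsLocalRing.closedPoint A :=
      PrimeSpectrum.ext (IsLocalRing.eq_maximalIdeal hmax)
    exact (key m hmc hm).mpr (h (hs.mp (hmc ▸ hm)))

end CohenMacaulayAt

/-! ### The filtration by dimension indexed by the natural numbers -/

section DimSub

theorem WithBot.enat_lt_natCast_succ_iff {x : WithBot ℕ∞} {n : ℕ} :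
    x < ((n + 1 : ℕ) : WithBot ℕ∞) ↔ x ≤ n := by
  induction x using WithBot.recBotCoe with
  | bot => simp
  | coe x =>
    have : x < ((n + 1 : ℕ) : ℕ∞) ↔ x ≤ n := by
      push_cast
      exact ENat.lt_add_one_iff (by simp)
    exact_mod_cast this

variable (R : Type*) [CommRing R] (M : Type*) [AddCommGroup M] [Module R M]

/-- The largest submodule of `M` of dimension smaller than `n`. -/
def dimSub (n : ℕ) : Submodule R M where
  carrier := {x | ∀ p : PrimeSpectrum R, n ≤ Order.coheight p → ∃ r ∉ p.asIdeal, r • x = 0}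
  zero_mem' := fun p _ => ⟨1, p.2.one_notMem, smul_zero _⟩
  add_mem' := by
    intro x y hx hy p hp
    obtain ⟨r, hr, hrx⟩ := hx p hp
    obtain ⟨s, hs, hsy⟩ := hy p hp
    refine ⟨r * s, fun h => (p.2.mem_or_mem h).elim hr hs, ?_⟩
    rw [smul_add, mul_smul, mul_smul, hsy, smul_zero, smul_comm, hrx, smul_zero, add_zero]
  smul_mem' := by
    intro c x hx p hp
    obtain ⟨r, hr, hrx⟩ := hx p hp
    exact ⟨r, hr, by rw [smul_comm, hrx, smul_zero]⟩

variable {R M}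

theorem le_dimSub_iff {n : ℕ} {N : Submodule R M} :
    N ≤ dimSub R M n ↔ Module.supportDim R N < n := by
  rw [supportDim_lt_iff]
  constructor
  · intro h p
    contrapose!
    intro hn
    rw [Module.notMem_support_iff']
    intro m
    obtain ⟨r, hr, hrm⟩ := h m.2 p hn
    exact ⟨r, hr, Subtype.ext hrm⟩
  · intro h x hx p hn
    obtain ⟨r, hr, hrm⟩ := Module.notMem_support_iff'.mp (fun hp => (h p hp).not_ge hn) ⟨x, hx⟩
    exact ⟨r, hr, congrArg Subtype.val hrm⟩

theorem supportDim_dimSub_lt (n : ℕ) : Module.supportDim R (dimSub R M n) < n :=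
  le_dimSub_iff.mp le_rfl

theorem dimSub_mono : Monotone (dimSub R M) := fun _ _ h _ hx p hp =>
  hx p (le_trans (by exact_mod_cast h) hp)

theorem dimSub_zero : dimSub R M 0 = ⊥ := by
  have h := supportDim_dimSub_lt (R := R) (M := M) 0
  by_contra hne
  have : Nontrivial (dimSub R M 0) := Submodule.nontrivial_iff_ne_bot.mpr hne
  obtain ⟨e, he⟩ := WithBot.ne_bot_iff_exists.mp
    (Module.supportDim_ne_bot_of_nontrivial R (dimSub R M 0))
  rw [← he] at h
  have h' : e < (0 : ℕ) := by exact_mod_cast h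
  simp at h'

theorem dimSub_eq_top_iff {n : ℕ} : dimSub R M n = ⊤ ↔ Module.supportDim R M < n := by
  rw [← top_le_iff, le_dimSub_iff, Module.supportDim_eq_of_equiv Submodule.topEquiv]

/-- If dim R/p < n, no prime p' with dim R/p' ≥ n contains p. A representative y of a class with
annihilator p is multiplied into `dimSub n` by some element outside p', hence vanishes at each such
p' and already lies in `dimSub n`. -/
theorem coheight_eq_of_mem_associatedPrimes_dimSub [IsNoetherianRing R] {n : ℕ}
    {p : PrimeSpectrum R}
    (hp : p.asIdeal ∈ associatedPrimes R
      (dimSub R M (n + 1) ⧸ (dimSub R M n).submoduleOf (dimSub R M (n + 1)))) :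
    Order.coheight p = n := by
  have h1 : Order.coheight p < (n + 1 : ℕ) := by
    refine supportDim_lt_iff.mp (supportDim_dimSub_lt (M := M) (n + 1)) p ?_
    exact Module.support_subset_of_surjective _ (Submodule.mkQ_surjective _)
      (mem_support_of_mem_associatedPrimes hp)
  refine le_antisymm (by push_cast at h1; exact (ENat.lt_add_one_iff (by simp)).mp h1) ?_
  by_contra! hlt
  obtain ⟨hprime, x, hx⟩ := mem_associatedPrimes_iff.mp hp
  obtain ⟨y, rfl⟩ := Submodule.mkQ_surjective _ x
  have hmem : ∀ r, r ∈ p.asIdeal ↔ r • (y : M) ∈ dimSub R M n := fun r => by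
    rw [hx, ← map_smul, Submodule.mkQ_apply, Submodule.Quotient.mk_eq_zero]
    rfl
  refine p.2.one_notMem ((hmem 1).mpr ?_)
  rw [one_smul]
  intro p' hp'
  obtain ⟨a, ha, ha'⟩ : ∃ a ∈ p.asIdeal, a ∉ p'.asIdeal := by
    by_contra! hcon
    exact (hlt.trans_le hp').not_ge (Order.coheight_anti (show p ≤ p' from hcon))
  obtain ⟨r, hr, hra⟩ := (hmem a).mp ha p' hp'
  exact ⟨r * a, fun h => (p'.2.mem_or_mem h).elim hr ha', by rw [mul_smul, hra]⟩

/-- Recognizes the filtration after localization. The layers below n vanish at primes of coheight at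
least n, which gives one inclusion. For the other, an element of `dimSub n` surviving in a layer k ≥
n would have its annihilator inside an associated prime of coheight k, but it is killed outside that
prime. -/
theorem eq_dimSub_of_coheight_eq [IsNoetherianRing R] [Module.Finite R M]
    (F : ℕ → Submodule R M) (hmono : Monotone F) (h0 : F 0 = ⊥) {N : ℕ} (hN : F N = ⊤)
    (hF : ∀ n, ∀ p : PrimeSpectrum R, p.asIdeal ∈ associatedPrimes R
      (F (n + 1) ⧸ (F n).submoduleOf (F (n + 1))) → Order.coheight p = n) (n : ℕ) :
    F n = dimSub R M n := by
  apply le_antisymm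
  · induction n with
    | zero => rw [h0]; exact bot_le
    | succ n ih =>
      intro x hx p' hp'
      have hns : p' ∉ Module.support R (F (n + 1) ⧸ (F n).submoduleOf (F (n + 1))) := by
        intro hs
        obtain ⟨p, hp, hle⟩ := exists_associatedPrime_le_of_mem_support hs
        have := hp'.trans ((Order.coheight_anti hle).trans (hF n p hp).le)
        norm_cast at this
        omega
      obtain ⟨r, hr, hrx⟩ := Module.notMem_support_iff'.mp hns
        (((F n).submoduleOf (F (n + 1))).mkQ ⟨x, hx⟩)
      rw [← map_smul, Submodule.mkQ_apply, Submodule.Quotient.mk_eq_zero] at hrx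
      have hrx' : r • x ∈ F n := hrx
      obtain ⟨s, hs, hsx⟩ := ih hrx' p' (le_trans (by exact_mod_cast n.le_succ) hp')
      exact ⟨s * r, fun h => (p'.2.mem_or_mem h).elim hs hr, by rw [mul_smul, hsx]⟩
  · have step : ∀ k, n ≤ k → dimSub R M n ≤ F (k + 1) → dimSub R M n ≤ F k := by
      intro k hk h x hx
      by_contra hxk
      have hne : ((F k).submoduleOf (F (k + 1))).mkQ ⟨x, h hx⟩ ≠ 0 := by
        rwa [Ne, Submodule.mkQ_apply, Submodule.Quotient.mk_eq_zero]
      obtain ⟨p, hp, hle⟩ := exists_le_isAssociatedPrime_of_isNoetherianRing R _ hne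
      obtain ⟨r, hr, hrx⟩ := hx ⟨p, hp.isPrime⟩ (by rw [hF k ⟨p, hp.isPrime⟩ hp]; exact_mod_cast hk)
      refine hr (hle ?_)
      rw [Submodule.mem_colon_singleton, ← map_smul]
      have : r • (⟨x, h hx⟩ : F (k + 1)) = 0 := Subtype.ext hrx
      rw [this, map_zero]
      exact zero_mem _
    have hall : ∀ j, dimSub R M n ≤ F (n + j) → dimSub R M n ≤ F n := by
      intro j
      induction j with
      | zero => exact id
      | succ j ih => exact fun h => ih (step (n + j) (by omega) h)
    refine hall N ?_
    rw [eq_top_iff.mpr (hN.ge.trans (hmono (Nat.le_add_left N n)))]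
    exact le_top

theorem IsCohenMacaulayModule.of_subsingleton [Subsingleton M] : IsCohenMacaulayModule R M := by
  intro m hm
  rw [Module.support_eq_empty] at hm
  exact hm.elim

/-! ### The dimension filtration of a finite-dimensional module versus its indexing by the naturals.
-/

section Finite

variable {N : ℕ} (hN : Module.supportDim R M < N)

include hN in
theorem exists_supportDim_eq_natCast {L : Submodule R M} (hL : L ≠ ⊥) :
    ∃ a < N, Module.supportDim R L = a := by
  have : Nontrivial L := Submodule.nontrivial_iff_ne_bot.mpr hL
  have hlt := (Module.supportDim_le_of_injective L.subtype L.subtype_injective).trans_lt hN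
  obtain ⟨e, he⟩ := WithBot.ne_bot_iff_exists.mp (Module.supportDim_ne_bot_of_nontrivial R L)
  rw [← he] at hlt ⊢
  have hlt' : e < N := by exact_mod_cast hlt
  obtain ⟨a, rfl⟩ := ENat.ne_top_iff_exists.mp (lt_top_of_lt hlt').ne
  exact ⟨a, by exact_mod_cast hlt', rfl⟩

-- The `a i` are the dimensions d_i. No submodule has a dimension strictly between consecutive ones,
-- so `dimSub` is constant there; the `+ 1` appears because `dimSub` bounds the dimension strictly.
include hN in
theorem IsDimensionFiltration.exists_eq_dimSub {l : ℕ} {D : Fin (l + 1) → Submodule R M}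
    (hD : IsDimensionFiltration D) : ∃ a : Fin l → ℕ,
      (∀ i, D i.succ = dimSub R M (a i + 1) ∧ D i.castSucc = dimSub R M (a i)) ∧
      ∀ n, (∀ i, n ≠ a i) → dimSub R M (n + 1) = dimSub R M n := by
  obtain ⟨d, hd, hrange, hD0, hDs⟩ := hD
  have hex : ∀ i, ∃ a : ℕ, d i = a := fun i => by
    obtain ⟨L, hL, hLd⟩ := hrange.le (Set.mem_range_self i)
    obtain ⟨a, -, ha⟩ := exists_supportDim_eq_natCast hN hL
    exact ⟨a, hLd ▸ ha⟩
  choose a ha using hex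
  have hlt : ∀ {i j}, i < j → a i < a j := fun {i j} hij => by
    have := hd hij
    rw [ha, ha] at this
    exact_mod_cast this
  have hsucc : ∀ i, D i.succ = dimSub R M (a i + 1) := fun i => by
    have := hDs i
    rw [ha] at this
    apply le_antisymm
    · rw [le_dimSub_iff, WithBot.enat_lt_natCast_succ_iff]
      exact this.1
    · exact this.2 (WithBot.enat_lt_natCast_succ_iff.mp (supportDim_dimSub_lt (a i + 1)))
  have hdims : ∀ n, dimSub R M n ≠ ⊥ →
      ∃ i, a i < n ∧ Module.supportDim R (dimSub R M n) = a i := fun n hn => by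
    obtain ⟨i, hi⟩ := hrange.ge ⟨dimSub R M n, hn, rfl⟩
    have := supportDim_dimSub_lt (R := R) (M := M) n
    rw [← hi, ha] at this
    exact ⟨i, by exact_mod_cast this, by rw [← hi, ha]⟩
  refine ⟨a, fun i => ⟨hsucc i, ?_⟩, fun n hn => ?_⟩
  · obtain ⟨l, rfl⟩ : ∃ k, l = k + 1 := ⟨l - 1, by have := i.2; omega⟩
    refine Fin.cases ?_ (fun j => ?_) i
    · rw [Fin.castSucc_zero, hD0]
      by_contra hne
      obtain ⟨k, hk, -⟩ := hdims _ (Ne.symm hne)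
      rcases (Fin.zero_le k).lt_or_eq with h | h
      · exact absurd (hlt h) (by omega)
      · rw [h] at hk; omega
    · rw [← Fin.succ_castSucc, hsucc]
      apply le_antisymm (dimSub_mono (hlt (Fin.castSucc_lt_succ)))
      by_cases hbot : dimSub R M (a j.succ) = ⊥
      · rw [hbot]; exact bot_le
      obtain ⟨k, hk, hkd⟩ := hdims _ hbot
      rw [le_dimSub_iff, hkd]
      have hkj : k ≤ j.castSucc := by
        by_contra hcon
        have hle : j.succ ≤ k := Fin.castSucc_lt_iff_succ_le.mp (not_le.mp hcon)
        rcases hle.lt_or_eq with h | h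
        · exact absurd (hlt h) (by omega)
        · rw [h] at hk; omega
      have : a k ≤ a j.castSucc := by
        rcases hkj.lt_or_eq with h | h
        · exact (hlt h).le
        · rw [h]
      exact_mod_cast Nat.lt_succ_of_le this
  · refine le_antisymm ?_ (dimSub_mono n.le_succ)
    by_cases hbot : dimSub R M (n + 1) = ⊥
    · rw [hbot]; exact bot_le
    obtain ⟨k, hk, hkd⟩ := hdims _ hbot
    rw [le_dimSub_iff, hkd]
    have : a k < n := lt_of_le_of_ne (Nat.lt_succ_iff.mp hk) (hn k).symm
    exact_mod_cast this

include hN in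
theorem exists_isDimensionFiltration :
    ∃ (l : ℕ) (D : Fin (l + 1) → Submodule R M), IsDimensionFiltration D := by
  classical
  let S : Finset ℕ := (Finset.range N).filter fun a => (a : WithBot ℕ∞) ∈ submoduleDims R M
  let e := S.orderEmbOfFin rfl
  refine ⟨S.card, Fin.cons ⊥ fun i => dimSub R M (e i + 1), fun i => ((e i : ℕ) : WithBot ℕ∞),
    fun i j hij => ?_, ?_, by simp, fun i => ⟨?_, fun L hL => ?_⟩⟩
  · have := e.strictMono hij
    change ((e i : ℕ) : WithBot ℕ∞) < ((e j : ℕ) : WithBot ℕ∞)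
    exact_mod_cast this
  · ext d
    constructor
    · rintro ⟨i, rfl⟩
      exact (Finset.mem_filter.mp (S.orderEmbOfFin_mem rfl i)).2
    · rintro ⟨L, hL, rfl⟩
      obtain ⟨a, haN, ha⟩ := exists_supportDim_eq_natCast hN hL
      have haS : a ∈ S := Finset.mem_filter.mpr ⟨Finset.mem_range.mpr haN, L, hL, ha⟩
      obtain ⟨i, hi⟩ : a ∈ Set.range e := by
        rw [Finset.range_orderEmbOfFin]
        exact haS
      exact ⟨i, by rw [ha, ← hi]⟩
  · rw [Fin.cons_succ]
    exact WithBot.enat_lt_natCast_succ_iff.mp (supportDim_dimSub_lt _)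
  · rw [Fin.cons_succ, le_dimSub_iff]
    exact WithBot.enat_lt_natCast_succ_iff.mpr hL

-- The steps added by indexing over ℕ have zero quotient, which is vacuously Cohen-Macaulay. The set
-- of dimensions, which may shift under localization, thereby disappears from the condition.
include hN in
theorem isSequentiallyCM_iff : IsSequentiallyCM R M ↔ ∀ n, IsCohenMacaulayModule R
    (dimSub R M (n + 1) ⧸ (dimSub R M n).submoduleOf (dimSub R M (n + 1))) := by
  constructor
  · rintro ⟨l, D, hD, hCM⟩ n
    obtain ⟨a, ha, hn⟩ := hD.exists_eq_dimSub hN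
    by_cases h : ∃ i, n = a i
    · obtain ⟨i, rfl⟩ := h
      have := hCM i
      rwa [(ha i).1, (ha i).2] at this
    · push Not at h
      rw [hn n h]
      have : Subsingleton (dimSub R M n ⧸ (dimSub R M n).submoduleOf (dimSub R M n)) := by
        rw [Submodule.submoduleOf_self]
        infer_instance
      exact .of_subsingleton
  · intro h
    obtain ⟨l, D, hD⟩ := exists_isDimensionFiltration hN
    obtain ⟨a, ha, -⟩ := hD.exists_eq_dimSub hN
    refine ⟨l, D, hD, fun i => ?_⟩
    rw [(ha i).1, (ha i).2]
    exact h (a i)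

end Finite

end DimSub

/-! ### Localization of the dimension filtration -/

section LocalizeDimSub

/-! ### Localization of subquotients. -/

section Subquotient

variable {R : Type*} [CommRing R] (S : Submonoid R)
  {A : Type*} [CommRing A] [Algebra R A] [IsLocalization S A]
  {M : Type*} [AddCommGroup M] [Module R M] {M' : Type*} [AddCommGroup M'] [Module R M']
  (f : M →ₗ[R] M') [IsLocalizedModule S f] [Module A M'] [IsScalarTower R A M']
  (E E' : Submodule R M)

theorem localized'_submoduleOf :
    (E.submoduleOf E').localized' A S (E'.toLocalized' A S f) =
      (E.localized' A S f).submoduleOf (E'.localized' A S f) := by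
  have hmk : ∀ (y : E') (s : S), ((IsLocalizedModule.mk' (E'.toLocalized' A S f) y s :
      E'.localized' A S f) : M') = IsLocalizedModule.mk' f (y : M) s := fun y s => by
    symm
    rw [IsLocalizedModule.mk'_eq_iff]
    have := congrArg Subtype.val
      (IsLocalizedModule.mk'_cancel' (E'.toLocalized' A S f) y s)
    exact this.symm
  ext ⟨x, hx⟩
  constructor
  · rintro ⟨y, hy, s, hs⟩
    exact ⟨y, hy, s, by rw [← hmk, hs]; rfl⟩
  · rintro ⟨y, hy, s, hs⟩
    obtain ⟨z, hz, t, ht⟩ := hx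
    have hs' : IsLocalizedModule.mk' f y s = x := hs
    obtain ⟨u, hu⟩ := (IsLocalizedModule.mk'_eq_mk'_iff f y z s t).mp (hs'.trans ht.symm)
    have hmem : u • t • y ∈ E' := by
      rw [← hu]
      exact E'.smul_mem u.1 (E'.smul_mem s.1 hz)
    refine ⟨⟨u • t • y, hmem⟩, E.smul_mem u.1 (E.smul_mem t.1 hy), u * (t * s), ?_⟩
    apply Subtype.ext
    rw [hmk]
    change IsLocalizedModule.mk' f (u • t • y) (u * (t * s)) = x
    rw [IsLocalizedModule.mk'_cancel_left, IsLocalizedModule.mk'_cancel_left, hs']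

theorem exists_isLocalizedModule_subquotient :
    ∃ g : (E' ⧸ E.submoduleOf E') →ₗ[R]
      (E'.localized' A S f ⧸ (E.localized' A S f).submoduleOf (E'.localized' A S f)),
      IsLocalizedModule S g := by
  let e := (Submodule.quotEquivOfEq _ _ (localized'_submoduleOf S (A := A) f E E')).restrictScalars R
  exact ⟨e.toLinearMap ∘ₗ (E.submoduleOf E').toLocalizedQuotient' A S (E'.toLocalized' A S f),
    IsLocalizedModule.of_linearEquiv S _ e⟩

end Subquotient

variable {R : Type*} [CommRing R] [IsNoetherianRing R] (q : PrimeSpectrum R)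
  {A : Type*} [CommRing A] [Algebra R A] [IsLocalization.AtPrime A q.asIdeal]
  {M : Type*} [AddCommGroup M] [Module R M] [Module.Finite R M]
  {M' : Type*} [AddCommGroup M'] [Module R M']
  (f : M →ₗ[R] M') [IsLocalizedModule q.asIdeal.primeCompl f] [Module A M'] [IsScalarTower R A M']

variable (R M) in
/-- The quotients of the filtration by dimension. -/
abbrev DimQuot (n : ℕ) : Type _ :=
  dimSub R M (n + 1) ⧸ (dimSub R M n).submoduleOf (dimSub R M (n + 1))

/-- If the heights of `q` over the associated primes `p ⊆ q` of `M` differ from the dimensions of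
the `R ⧸ p` by a constant, then the filtration by dimension localizes at `q`, up to a shift. -/
theorem dimSub_atPrime_eq {c N : ℕ} (hN : Module.supportDim R M < N)
    (hc : ∀ k, ∀ p : PrimeSpectrum R, p.asIdeal ∈ associatedPrimes R (DimQuot R M k) → p ≤ q →
      relHeight p q + c = k) (n : ℕ) :
    (dimSub R M (c + n)).localized' A q.asIdeal.primeCompl f = dimSub A M' n := by
  have hA : IsNoetherianRing A :=
    IsLocalization.isNoetherianRing q.asIdeal.primeCompl A inferInstance
  have hfin : Module.Finite A M' := Module.Finite.of_isLocalizedModule q.asIdeal.primeCompl f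
  have hmono : Monotone fun L : Submodule R M => L.localized' A q.asIdeal.primeCompl f :=
    (Submodule.localized'gi A q.asIdeal.primeCompl f).gc.monotone_l
  refine eq_dimSub_of_coheight_eq
    (fun n => (dimSub R M (c + n)).localized' A q.asIdeal.primeCompl f)
    (fun a b hab => hmono (dimSub_mono (by omega))) ?_ (N := N) ?_ ?_ n
  -- The layers k < c vanish at q: an associated prime p ⊆ q of one would give k = ht(q/p) + c ≥ c.
  · have : ∀ k ≤ c, (dimSub R M k).localized' A q.asIdeal.primeCompl f = ⊥ := by
      intro k
      induction k with
      | zero => intro _; rw [dimSub_zero, Submodule.localized'_bot]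
      | succ k ih =>
        intro hk
        rw [← ih (by omega)]
        refine le_antisymm ?_ (hmono (dimSub_mono k.le_succ))
        have hns : q ∉ Module.support R (DimQuot R M k) := fun hs => by
          obtain ⟨p, hp, hle⟩ := exists_associatedPrime_le_of_mem_support hs
          have h1 := hc k p hp hle
          have h2 : (c : ℕ∞) ≤ k := h1 ▸ le_add_self
          norm_cast at h2
          omega
        rw [Submodule.localized'_eq_span, Submodule.span_le]
        rintro _ ⟨x, hx, rfl⟩
        obtain ⟨r, hr, hrx⟩ := Module.notMem_support_iff'.mp hns
          (((dimSub R M k).submoduleOf (dimSub R M (k + 1))).mkQ ⟨x, hx⟩)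
        rw [← map_smul, Submodule.mkQ_apply, Submodule.Quotient.mk_eq_zero] at hrx
        refine ⟨r • x, hrx, ⟨r, hr⟩, ?_⟩
        rw [IsLocalizedModule.mk'_eq_iff, map_smul]
        rfl
    exact this c le_rfl
  · have : dimSub R M (c + N) = ⊤ := by
      rw [eq_top_iff, ← dimSub_eq_top_iff.mpr hN]
      exact dimSub_mono (by omega)
    simp only [this, Submodule.localized'_top]
  · intro n P hP
    obtain ⟨g, hg⟩ := exists_isLocalizedModule_subquotient (A := A) q.asIdeal.primeCompl f
      (dimSub R M (c + n)) (dimSub R M (c + n + 1))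
    have h1 := hc (c + n) _ ((mem_associatedPrimes_iff_comap q g P).mp hP)
      (comap_le_of_isLocalization_atPrime q P)
    rw [coheight_eq_relHeight_comap q]
    rw [add_comm] at h1
    push_cast at h1
    exact ENat.add_right_injective_of_ne_top (by simp) h1

-- The n-th layer of M' is the localization of the layer c + n of M, and the layers below c do not
-- have q in their support.
include f in
theorem isSequentiallyCM_atPrime_iff {c N : ℕ} (hN : Module.supportDim R M < N)
    (hc : ∀ k, ∀ p : PrimeSpectrum R, p.asIdeal ∈ associatedPrimes R (DimQuot R M k) → p ≤ q →
      relHeight p q + c = k) :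
    IsSequentiallyCM A M' ↔
      ∀ k, q ∈ Module.support R (DimQuot R M k) → ∃ n, IsCMAt (DimQuot R M k) q n := by
  have hN' : Module.supportDim A M' < N := by
    rw [← dimSub_eq_top_iff, ← dimSub_atPrime_eq q f hN hc, eq_top_iff,
      ← Submodule.localized'_top A q.asIdeal.primeCompl f]
    refine (Submodule.localized'gi A q.asIdeal.primeCompl f).gc.monotone_l ?_
    rw [← dimSub_eq_top_iff.mpr hN]
    exact dimSub_mono (by omega)
  rw [isSequentiallyCM_iff hN']
  have key : ∀ n, IsCohenMacaulayModule A
      (dimSub A M' (n + 1) ⧸ (dimSub A M' n).submoduleOf (dimSub A M' (n + 1))) ↔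
      (q ∈ Module.support R (DimQuot R M (c + n)) → ∃ m, IsCMAt (DimQuot R M (c + n)) q m) := by
    intro n
    obtain ⟨g, hg⟩ := exists_isLocalizedModule_subquotient (A := A) q.asIdeal.primeCompl f
      (dimSub R M (c + n)) (dimSub R M (c + n + 1))
    rw [← isCohenMacaulayModule_atPrime_iff (A := A) q g, ← dimSub_atPrime_eq q f hN hc,
      ← dimSub_atPrime_eq q f hN hc]
    rfl
  simp only [key]
  refine ⟨fun h k hk => ?_, fun h n => h (c + n)⟩
  obtain ⟨p, hp, hle⟩ := exists_associatedPrime_le_of_mem_support hk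
  have h1 := hc k p hp hle
  have h2 : (c : ℕ∞) ≤ k := h1 ▸ le_add_self
  obtain ⟨n, rfl⟩ : ∃ n, k = c + n := ⟨k - c, by norm_cast at h2; omega⟩
  exact h n hk

end LocalizeDimSub

/-! ### Primes of a `ℤ`-graded ring -/

section GradedPrimes

open DirectSum

variable {R : Type*} [CommRing R] (𝒜 : ℤ → AddSubgroup R) [GradedRing 𝒜]

/-- The prime generated by the homogeneous elements of a prime. -/
def homCore (q : PrimeSpectrum R) : PrimeSpectrum R :=
  ⟨(q.asIdeal.homogeneousCore 𝒜).toIdeal, q.2.homogeneousCore⟩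

theorem homCore_le (q : PrimeSpectrum R) : homCore 𝒜 q ≤ q :=
  Ideal.toIdeal_homogeneousCore_le 𝒜 q.asIdeal

theorem homCore_isHomogeneous (q : PrimeSpectrum R) : (homCore 𝒜 q).asIdeal.IsHomogeneous 𝒜 :=
  (q.asIdeal.homogeneousCore 𝒜).isHomogeneous

theorem homCore_mono : Monotone (homCore 𝒜) := fun _ _ h => Ideal.homogeneousCore_mono 𝒜 h

variable {𝒜}

theorem le_homCore {p q : PrimeSpectrum R} (hp : p.asIdeal.IsHomogeneous 𝒜) (hpq : p ≤ q) :
    p ≤ homCore 𝒜 q := by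
  have h := Ideal.homogeneousCore_mono 𝒜 hpq
  have h' : (p.asIdeal.homogeneousCore 𝒜).toIdeal ≤ (homCore 𝒜 q).asIdeal := h
  rwa [hp.toIdeal_homogeneousCore_eq_self] at h'

theorem homCore_eq_of_isHomogeneous {q : PrimeSpectrum R} (hq : q.asIdeal.IsHomogeneous 𝒜) :
    homCore 𝒜 q = q :=
  le_antisymm (homCore_le 𝒜 q) (le_homCore hq le_rfl)

theorem mem_homCore_of_mem {q : PrimeSpectrum R} {i : ℤ} {x : R} (hx : x ∈ 𝒜 i)
    (hxq : x ∈ q.asIdeal) : x ∈ (homCore 𝒜 q).asIdeal :=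
  Ideal.mem_homogeneousCore_of_homogeneous_of_mem ⟨i, hx⟩ hxq

variable (𝒜) in
theorem exists_forall_decompose_eq_zero (x : R) :
    ∃ (a : ℤ) (k : ℕ), ∀ i, i < a ∨ a + k < i → (decompose 𝒜 x i : R) = 0 := by
  classical
  let s := (decompose 𝒜 x).support
  obtain ⟨a, ha⟩ := s.bddBelow
  obtain ⟨b, hb⟩ := s.bddAbove
  refine ⟨a, (b - a).toNat, fun i hi => ?_⟩
  by_contra hne
  have his : i ∈ s := DFinsupp.mem_support_iff.mpr fun h => hne (by rw [h]; rfl)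
  have h1 := ha his
  have h2 := hb his
  have := Int.self_le_toNat (b - a)
  omega

/-- There is no prime strictly between a prime and its homogeneous core. -/
theorem eq_of_homCore_lt [IsNoetherianRing R] {r q : PrimeSpectrum R} (h : homCore 𝒜 q < r)
    (hrq : r ≤ q) : r = q := by
  classical
  set I := (homCore 𝒜 q).asIdeal with hI
  have hIhom : I.IsHomogeneous 𝒜 := homCore_isHomogeneous 𝒜 q
  have hIq : I ≤ q.asIdeal := homCore_le 𝒜 q
  -- Modulo I, g is concentrated in degrees b to b + k. An f in q outside I with the shortest window
  -- is chosen below; its top component c is not in q, as otherwise c ∈ I and the window would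
  -- shrink.
  let Good : R → ℤ → ℕ → Prop := fun g b k =>
    g ∈ q.asIdeal ∧ ∀ i, i < b ∨ b + k < i → (decompose 𝒜 g i : R) ∈ I
  have hex : ∃ k, ∃ g b, g ∉ I ∧ Good g b k := by
    obtain ⟨g, hgr, hgI⟩ := SetLike.exists_of_lt (show I < r.asIdeal from h)
    obtain ⟨b, k, hk⟩ := exists_forall_decompose_eq_zero 𝒜 g
    exact ⟨k, g, b, hgI, hrq hgr, fun i hi => by rw [hk i hi]; exact zero_mem _⟩
  obtain ⟨f, a, hfI, hfq, hf⟩ := Nat.find_spec hex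
  set l := Nat.find hex with hl
  have hmin : ∀ k < l, ∀ g b, Good g b k → g ∈ I := fun k hk g b hg => by
    by_contra hgI
    exact Nat.find_min hex hk ⟨g, b, hgI, hg⟩
  set c : R := (decompose 𝒜 f (a + l) : R) with hc
  have hc𝒜 : c ∈ 𝒜 (a + l) := (decompose 𝒜 f (a + l)).2
  have hcq : c ∉ q.asIdeal := by
    intro hcq
    have hcI : c ∈ I := mem_homCore_of_mem hc𝒜 hcq
    rcases Nat.eq_zero_or_pos l with h0 | h0
    · refine hfI (hIhom.mem_iff.mpr fun i => ?_)
      by_cases hi : i = a + l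
      · rw [hi]; exact hcI
      · exact hf i (by omega)
    · refine hfI (hmin (l - 1) (by omega) f a ⟨hfq, fun i hi => ?_⟩)
      by_cases hi' : i = a + l
      · rw [hi']; exact hcI
      · exact hf i (by omega)
  have hlpos : 0 < l := by
    by_contra h0
    refine hcq ?_
    have hfc : f - c ∈ I := hIhom.mem_iff.mpr fun i => by
      rw [decompose_sub, DirectSum.sub_apply, AddSubgroup.coe_sub]
      by_cases hi : i = a + l
      · rw [hi, decompose_of_mem_same 𝒜 hc𝒜, sub_self]
        exact zero_mem _
      · rw [decompose_of_mem_ne 𝒜 hc𝒜 (Ne.symm hi), sub_zero]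
        exact hf i (by omega)
    have := q.asIdeal.sub_mem hfq (hIq hfc)
    rwa [sub_sub_cancel] at this
  -- Pseudo-division by f: with e the top component of g, the difference c g - f e has a shorter
  -- window modulo I, and windows shorter than l force membership in I. As c ∉ q, this makes q
  -- minimal over I + (f), and Krull's principal ideal theorem bounds the height of q/I by one.
  have key : ∀ k, ∀ g b, Good g b k → ∃ n, c ^ n * g ∈ I ⊔ Ideal.span {f} := by
    intro k
    induction k with
    | zero =>
      intro g b hg
      exact ⟨0, Ideal.mem_sup_left (by simpa using hmin 0 hlpos g b hg)⟩
    | succ k ih =>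
      intro g b hg
      by_cases hkl : k + 1 < l
      · exact ⟨0, Ideal.mem_sup_left (by simpa using hmin _ hkl g b hg)⟩
      have hlead : (decompose 𝒜 g (b + (k + 1 : ℕ)) : R) ∈ 𝒜 (b + (k + 1 : ℕ)) :=
        (decompose 𝒜 g (b + (k + 1 : ℕ))).2
      set e : R := (decompose 𝒜 g (b + (k + 1 : ℕ)) : R) with he
      obtain ⟨n, hn⟩ := ih (c * g - f * e) (a + l + b)
        ⟨q.asIdeal.sub_mem (q.asIdeal.mul_mem_left _ hg.1) (q.asIdeal.mul_mem_right _ hfq), by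
          intro i hi
          have h1 : (decompose 𝒜 (c * g) i : R) = c * decompose 𝒜 g (i - (a + l)) := by
            rw [← coe_decompose_mul_add_of_left_mem 𝒜 hc𝒜, add_sub_cancel]
          have h2 : (decompose 𝒜 (f * e) i : R) =
              decompose 𝒜 f (i - (b + (k + 1 : ℕ))) * e := by
            rw [← coe_decompose_mul_add_of_right_mem 𝒜 hlead, sub_add_cancel]
          rw [decompose_sub, DirectSum.sub_apply, AddSubgroup.coe_sub, h1, h2]
          by_cases hi' : i = a + l + b + (k + 1 : ℕ)
          · have e1 : i - (a + l) = b + (k + 1 : ℕ) := by omega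
            have e2 : i - (b + (k + 1 : ℕ)) = a + l := by omega
            rw [e1, e2, ← he, ← hc, sub_self]
            exact zero_mem _
          · exact I.sub_mem (I.mul_mem_left _ (hg.2 _ (by omega)))
              (I.mul_mem_right _ (hf _ (by omega)))⟩
      refine ⟨n + 1, ?_⟩
      have : c ^ (n + 1) * g = c ^ n * (c * g - f * e) + (c ^ n * e) * f := by ring
      rw [this]
      exact Ideal.add_mem _ hn (Ideal.mem_sup_right
        (Ideal.mul_mem_left _ _ (Ideal.mem_span_singleton_self f)))
  have hqmin : q.asIdeal ∈ (I ⊔ Ideal.span {f}).minimalPrimes := by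
    refine ⟨⟨q.2, sup_le hIq ((Ideal.span_singleton_le_iff_mem _).mpr hfq)⟩, ?_⟩
    rintro J ⟨hJ, hle⟩ hJq g hg
    obtain ⟨b, k, hk⟩ := exists_forall_decompose_eq_zero 𝒜 g
    obtain ⟨n, hn⟩ := key k g b ⟨hg, fun i hi => by rw [hk i hi]; exact zero_mem _⟩
    refine (hJ.mem_or_mem (hle hn)).resolve_left fun hcn => hcq (hJq (hJ.mem_of_pow_mem n hcn))
  have hht := Ideal.map_height_le_one_of_mem_minimalPrimes hqmin
  by_contra hne
  have hrq' : r < q := lt_of_le_of_ne hrq hne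
  have hker : ∀ J : Ideal R, I ≤ J → (J.map (Ideal.Quotient.mk I)).comap (Ideal.Quotient.mk I) = J :=
    fun J hJ => by rw [Ideal.comap_map_of_surjective _ Ideal.Quotient.mk_surjective,
      ← RingHom.ker_eq_comap_bot, Ideal.mk_ker, sup_eq_left.mpr hJ]
  have hprime : ∀ J : Ideal R, J.IsPrime → I ≤ J → (J.map (Ideal.Quotient.mk I)).IsPrime :=
    fun J hJ hle => Ideal.map_isPrime_of_surjective Ideal.Quotient.mk_surjective
      (by rwa [Ideal.mk_ker])
  have hlt : ∀ J K : Ideal R, I ≤ J → J < K →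
      J.map (Ideal.Quotient.mk I) < K.map (Ideal.Quotient.mk I) := fun J K hJ hJK => by
    refine lt_of_le_of_ne (Ideal.map_mono hJK.le) fun heq => hJK.ne ?_
    rw [← hker J hJ, heq, hker K (hJ.trans hJK.le)]
  have := hprime I (homCore 𝒜 q).2 le_rfl
  have := hprime r.asIdeal r.2 h.le
  have := hprime q.asIdeal q.2 hIq
  have t1 := Ideal.height_add_one_le_of_lt_of_isPrime (hlt I r.asIdeal le_rfl h)
  have t2 := Ideal.height_add_one_le_of_lt_of_isPrime (hlt r.asIdeal q.asIdeal h.le hrq')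
  have t3 : (2 : ℕ∞) ≤ 1 := by
    calc (2 : ℕ∞) = 0 + 1 + 1 := by norm_num
      _ ≤ _ := add_le_add_left ((add_le_add_left zero_le 1).trans t1) 1
      _ ≤ 1 := t2.trans hht
  exact absurd t3 (by decide)

theorem relHeight_le_relHeight_homCore_add_one [IsNoetherianRing R] {p q : PrimeSpectrum R}
    (hp : p.asIdeal.IsHomogeneous 𝒜) :
    relHeight p q ≤ relHeight p (homCore 𝒜 q) + 1 := by
  have key : ∀ n, ∀ s : LTSeries (PrimeSpectrum R), s.length = n → p ≤ s.head →
      (n : ℕ∞) ≤ relHeight p (homCore 𝒜 s.last) + 1 := by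
    intro n
    induction n with
    | zero => intro s _ _; simp
    | succ n ih =>
      intro s hs hps
      have hne : s.length ≠ 0 := by omega
      have hlt : s.eraseLast.last < s.last := s.eraseLast_last_rel_last hne
      have hlen : s.eraseLast.length = n := by simp [hs]
      have hhead : p ≤ s.eraseLast.head := by simpa using hps
      have hple : p ≤ s.eraseLast.last := hhead.trans (LTSeries.monotone _ (Fin.zero_le _))
      push_cast
      gcongr
      -- Let r be the last prime but one. If r is homogeneous, it lies in q* and so does the
      -- shortened chain. Otherwise r* ≠ q*, since r would lie strictly between q* and q, and the
      -- step from r* to q* makes up for the lost link.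
      by_cases hr : homCore 𝒜 s.eraseLast.last = s.eraseLast.last
      · rw [← hlen]
        refine length_le_relHeight hhead ?_
        exact le_homCore (hr ▸ homCore_isHomogeneous 𝒜 _) hlt.le
      · refine (ih s.eraseLast hlen hhead).trans
          (relHeight_add_one_le_of_lt_right (le_homCore hp hple) ?_)
        refine lt_of_le_of_ne (homCore_mono 𝒜 hlt.le) fun heq => hlt.ne ?_
        refine eq_of_homCore_lt (𝒜 := 𝒜) ?_ hlt.le
        rw [← heq]
        exact lt_of_le_of_ne (homCore_le 𝒜 _) hr
  refine relHeight_le fun s h₁ h₂ => (key _ s rfl h₁).trans ?_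
  gcongr
  exact relHeight_mono le_rfl (homCore_mono 𝒜 h₂)

theorem relHeight_eq_relHeight_homCore_add_one [IsNoetherianRing R] {p q : PrimeSpectrum R}
    (hp : p.asIdeal.IsHomogeneous 𝒜) (hpq : p ≤ q) (hq : homCore 𝒜 q ≠ q) :
    relHeight p q = relHeight p (homCore 𝒜 q) + 1 :=
  le_antisymm (relHeight_le_relHeight_homCore_add_one hp)
    (relHeight_add_one_le_of_lt_right (le_homCore hp hpq) (lt_of_le_of_ne (homCore_le 𝒜 q) hq))

/-- A prime which is not homogeneous provides a homogeneous element of nonzero degree outside of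
its homogeneous core. -/
theorem exists_degree_ne_zero_notMem_homCore {q : PrimeSpectrum R} (hq : homCore 𝒜 q ≠ q) :
    ∃ (e : ℤ) (t : R), e ≠ 0 ∧ t ∈ 𝒜 e ∧ t ∉ (homCore 𝒜 q).asIdeal := by
  -- If all elements of nonzero degree lie in q*, each x in q is congruent modulo q* to its
  -- degree-zero component, which is then in q and so in q*.
  by_contra! hcon
  refine hq (le_antisymm (homCore_le 𝒜 q) fun x hx => ?_)
  set I := (homCore 𝒜 q).asIdeal with hI
  have hIhom : I.IsHomogeneous 𝒜 := homCore_isHomogeneous 𝒜 q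
  have hcomp : ∀ i, i ≠ 0 → (decompose 𝒜 x i : R) ∈ I := fun i hi =>
    hcon i _ hi (decompose 𝒜 x i).2
  refine hIhom.mem_iff.mpr fun i => ?_
  by_cases hi : i = 0
  · subst hi
    refine mem_homCore_of_mem (decompose 𝒜 x 0).2 ?_
    have hx0 : x - decompose 𝒜 x 0 ∈ I := hIhom.mem_iff.mpr fun j => by
      rw [decompose_sub, DirectSum.sub_apply, AddSubgroup.coe_sub]
      by_cases hj : j = 0
      · rw [hj, decompose_of_mem_same 𝒜 (decompose 𝒜 x 0).2, sub_self]
        exact zero_mem _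
      · rw [decompose_of_mem_ne 𝒜 (decompose 𝒜 x 0).2 (Ne.symm hj), sub_zero]
        exact hcomp j hj
    have := q.asIdeal.sub_mem hx (homCore_le 𝒜 q hx0)
    rwa [sub_sub_cancel] at this
  · exact hcomp i hi

theorem Ideal.IsHomogeneous.exists_notMem_of_not_le {I J : Ideal R} (hI : I.IsHomogeneous 𝒜)
    (h : ¬ I ≤ J) : ∃ (i : ℤ) (x : R), x ∈ 𝒜 i ∧ x ∈ I ∧ x ∉ J := by
  classical
  by_contra! hcon
  refine h fun x hx => ?_
  rw [← sum_support_decompose 𝒜 x]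
  exact J.sum_mem fun i _ => hcon i _ (decompose 𝒜 x i).2 (hI i hx)

/-- The usual avoidance argument adds an x avoiding the earlier primes to a y avoiding only the new
one, which destroys homogeneity. Powers of t, which lies in no prime of T because these are inside
I, equalize the degrees first. -/
theorem exists_homogeneous_forall_notMem_of_antichain {I : Ideal R} (hI : I.IsHomogeneous 𝒜)
    {e : ℤ} {t : R} (he : e ≠ 0) (ht : t ∈ 𝒜 e) (htI : t ∉ I) (T : Finset (Ideal R))
    (hT : ∀ p ∈ T, p.IsPrime ∧ p.IsHomogeneous 𝒜 ∧ p < I)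
    (hanti : ∀ p ∈ T, ∀ p' ∈ T, p ≤ p' → p = p') :
    ∃ (d : ℤ) (x : R), x ∈ 𝒜 d ∧ x ∈ I ∧ ∀ p ∈ T, x ∉ p := by
  classical
  induction T using Finset.induction_on with
  | empty => exact ⟨0, 0, zero_mem _, zero_mem _, by simp⟩
  | insert p T hpT ih =>
    obtain ⟨d, x, hxd, hxI, hxT⟩ := ih (fun p hp => hT p (Finset.mem_insert_of_mem hp))
      fun p hp p' hp' => hanti p (Finset.mem_insert_of_mem hp) p' (Finset.mem_insert_of_mem hp')
    by_cases hxp : x ∈ p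
    swap
    · exact ⟨d, x, hxd, hxI, fun p' hp' => (Finset.mem_insert.mp hp').elim
        (fun h => h ▸ hxp) (hxT p')⟩
    obtain ⟨hpprime, -, hpI⟩ := hT p (Finset.mem_insert_self p T)
    obtain ⟨d', y, hyd, hyI, hyT, hyp⟩ : ∃ (d' : ℤ) (y : R), y ∈ 𝒜 d' ∧ y ∈ I ∧
        (∀ p' ∈ T, y ∈ p') ∧ y ∉ p := by
      have haux : ∀ U ⊆ T, ∃ (d' : ℤ) (y : R), y ∈ 𝒜 d' ∧ y ∈ I ∧ (∀ p' ∈ U, y ∈ p') ∧ y ∉ p := by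
        intro U
        induction U using Finset.induction_on with
        | empty =>
          intro _
          obtain ⟨i, y, h1, h2, h3⟩ := hI.exists_notMem_of_not_le hpI.not_ge
          exact ⟨i, y, h1, h2, by simp, h3⟩
        | insert p' U _ ihU =>
          intro hU
          obtain ⟨d', y, h1, h2, h3, h4⟩ := ihU ((Finset.subset_insert _ _).trans hU)
          have hp'T : p' ∈ T := hU (Finset.mem_insert_self _ _)
          obtain ⟨i, z, z1, z2, z3⟩ :=
            (hT p' (Finset.mem_insert_of_mem hp'T)).2.1.exists_notMem_of_not_le (J := p)
              fun hle => hpT (hanti p' (Finset.mem_insert_of_mem hp'T) p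
                (Finset.mem_insert_self p T) hle ▸ hp'T)
          refine ⟨i + d', z * y, SetLike.GradedMul.mul_mem z1 h1, I.mul_mem_left _ h2,
            fun p'' hp'' => ?_, fun h => (hpprime.mem_or_mem h).elim z3 h4⟩
          rcases Finset.mem_insert.mp hp'' with rfl | h
          · exact Ideal.mul_mem_right _ _ z2
          · exact Ideal.mul_mem_left _ _ (h3 p'' h)
      exact haux T subset_rfl
    -- With A = |e|, the difference A(d - d') is a multiple of e; its quotient is split into its
    -- positive and negative parts to give natural exponents of t.
    obtain ⟨A, B, D, hA, hdeg⟩ : ∃ A B D : ℕ, A ≠ 0 ∧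
        (A : ℤ) * d + B * e = A * d' + D * e := by
      rcases lt_or_gt_of_ne he with h | h
      · refine ⟨e.natAbs, (d - d').toNat, (d' - d).toNat, by omega, ?_⟩
        have h1 : (e.natAbs : ℤ) = -e := by omega
        have h2 : ((d - d').toNat : ℤ) - (d' - d).toNat = d - d' := by omega
        rw [h1]
        linear_combination e * h2
      · refine ⟨e.natAbs, (d' - d).toNat, (d - d').toNat, by omega, ?_⟩
        have h1 : (e.natAbs : ℤ) = e := by omega
        have h2 : ((d' - d).toNat : ℤ) - (d - d').toNat = d' - d := by omega
        rw [h1]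
        linear_combination e * h2
    have hx1 : x ^ A * t ^ B ∈ 𝒜 ((A : ℤ) * d + B * e) := by
      have h1 := SetLike.pow_mem_graded A hxd
      have h2 := SetLike.pow_mem_graded B ht
      simpa using SetLike.GradedMul.mul_mem h1 h2
    have hy1 : y ^ A * t ^ D ∈ 𝒜 ((A : ℤ) * d + B * e) := by
      rw [hdeg]
      have h1 := SetLike.pow_mem_graded A hyd
      have h2 := SetLike.pow_mem_graded D ht
      simpa using SetLike.GradedMul.mul_mem h1 h2
    refine ⟨_, x ^ A * t ^ B + y ^ A * t ^ D, add_mem hx1 hy1, ?_, fun p' hp' => ?_⟩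
    · exact I.add_mem (I.mul_mem_right _ (I.pow_mem_of_mem hxI A (by omega)))
        (I.mul_mem_right _ (I.pow_mem_of_mem hyI A (by omega)))
    · obtain ⟨hp'prime, -, hp'I⟩ := hT p' hp'
      have htp' : t ∉ p' := fun h => htI (hp'I.le h)
      have hprod : ∀ z : R, ∀ n : ℕ, z ∉ p' → z ^ A * t ^ n ∉ p' := fun z n hz h =>
        (hp'prime.mem_or_mem h).elim (fun h => hz (hp'prime.mem_of_pow_mem _ h))
          fun h => htp' (hp'prime.mem_of_pow_mem _ h)
      rcases Finset.mem_insert.mp hp' with rfl | h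
      · have hmem : x ^ A * t ^ B ∈ p' := p'.mul_mem_right _ (p'.pow_mem_of_mem hxp A (by omega))
        rw [Ideal.add_mem_iff_right _ hmem]
        exact hprod y D hyp
      · have hmem : y ^ A * t ^ D ∈ p' :=
          p'.mul_mem_right _ (p'.pow_mem_of_mem (hyT p' h) A (by omega))
        rw [Ideal.add_mem_iff_left _ hmem]
        exact hprod x B (hxT p' h)

/-- Homogeneous prime avoidance. -/
theorem exists_homogeneous_forall_notMem {I : Ideal R} (hI : I.IsHomogeneous 𝒜)
    {e : ℤ} {t : R} (he : e ≠ 0) (ht : t ∈ 𝒜 e) (htI : t ∉ I) {T : Set (Ideal R)} (hfin : T.Finite)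
    (hT : ∀ p ∈ T, p.IsPrime ∧ p.IsHomogeneous 𝒜 ∧ p < I) :
    ∃ (d : ℤ) (x : R), x ∈ 𝒜 d ∧ x ∈ I ∧ ∀ p ∈ T, x ∉ p := by
  have hfin' : {p | Maximal (· ∈ T) p}.Finite := hfin.subset fun p hp => hp.1
  obtain ⟨d, x, hxd, hxI, hx⟩ := exists_homogeneous_forall_notMem_of_antichain hI he ht htI
    hfin'.toFinset (fun p hp => hT p (hfin'.mem_toFinset.mp hp).1)
    fun p hp p' hp' hle => le_antisymm hle
      ((hfin'.mem_toFinset.mp hp).2 (hfin'.mem_toFinset.mp hp').1 hle)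
  refine ⟨d, x, hxd, hxI, fun p hp hxp => ?_⟩
  obtain ⟨p', hle, hp'⟩ := hfin.exists_le_maximal hp
  exact hx p' (hfin'.mem_toFinset.mpr hp') (hle hxp)

end GradedPrimes

/-! ### Graded modules -/

section GradedModules

open DirectSum

variable {R : Type*} [CommRing R] (𝒜 : ℤ → AddSubgroup R) [GradedRing 𝒜]

/-- A grading of an `R`-module, given by the projections to its components. -/
structure ModuleGrading (M : Type*) [AddCommGroup M] [Module R M] where
  /-- The projections to the components. -/
  proj : ℤ → M →+ M
  finite : ∀ x, {i | proj i x ≠ 0}.Finite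
  -- Stands in for x being the sum of its components; in this form it passes to submodules by images
  -- and to quotients by preimages.
  mem_of_forall_mem : ∀ (x : M) (N : AddSubgroup M), (∀ i, proj i x ∈ N) → x ∈ N
  proj_smul : ∀ {i : ℤ} {a : R}, a ∈ 𝒜 i → ∀ (j : ℤ) (x : M),
    proj (i + j) (a • x) = a • proj j x

namespace ModuleGrading

variable {𝒜} {M : Type*} [AddCommGroup M] [Module R M]

/-- The projections of a decomposition. -/
def ofDecomposition (ℳ : ℤ → AddSubgroup M) [Decomposition ℳ] [SetLike.GradedSMul 𝒜 ℳ] :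
    ModuleGrading 𝒜 M where
  proj i := AddMonoidHom.mk' (fun x => (decompose ℳ x i : M)) fun x y => by
    rw [decompose_add, DirectSum.add_apply, AddSubgroup.coe_add]
  finite x := by
    classical
    refine (decompose ℳ x).support.finite_toSet.subset fun i hi => ?_
    exact DFinsupp.mem_support_iff.mpr fun h => hi (by simp [h])
  mem_of_forall_mem x N h := by
    classical
    rw [← sum_support_decompose ℳ x]
    exact N.sum_mem fun i _ => h i
  proj_smul {i a} ha j x := by
    classical
    change (decompose ℳ (a • x) (i + j) : M) = a • (decompose ℳ x j : M)
    conv_lhs => rw [← sum_support_decompose ℳ x, Finset.smul_sum, decompose_sum]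
    rw [DirectSum.sum_apply, AddSubgroup.val_finsetSum]
    have hmem : ∀ k, a • (decompose ℳ x k : M) ∈ ℳ (i + k) := fun k =>
      SetLike.GradedSMul.smul_mem ha (decompose ℳ x k).2
    rw [Finset.sum_eq_single j]
    · exact decompose_of_mem_same ℳ (hmem j)
    · intro k _ hk
      exact decompose_of_mem_ne ℳ (hmem k) (by omega)
    · intro hj
      rw [DFinsupp.notMem_support_iff.mp hj]
      simp

variable (G : ModuleGrading 𝒜 M)

omit [GradedRing 𝒜] in
theorem eq_zero_of_forall {x : M} (h : ∀ i, G.proj i x = 0) : x = 0 :=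
  G.mem_of_forall_mem x ⊥ fun i => h i

/-- The grading of a homogeneous submodule. -/
def restrict (N : Submodule R M) (hN : ∀ i, ∀ x ∈ N, G.proj i x ∈ N) : ModuleGrading 𝒜 N where
  proj i := AddMonoidHom.mk' (fun x => ⟨G.proj i x, hN i x x.2⟩) fun x y =>
    Subtype.ext (by simp)
  finite x := (G.finite x).subset fun i hi h => hi (Subtype.ext h)
  mem_of_forall_mem x L h := by
    obtain ⟨y, hy, hyx⟩ := G.mem_of_forall_mem x (L.map N.subtype.toAddMonoidHom)
      fun i => ⟨_, h i, rfl⟩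
    rwa [← Subtype.ext (show (y : M) = x from hyx)]
  proj_smul ha j x := Subtype.ext (G.proj_smul ha j x)

/-- The grading of the quotient by a homogeneous submodule. -/
def quotient (N : Submodule R M) (hN : ∀ i, ∀ x ∈ N, G.proj i x ∈ N) :
    ModuleGrading 𝒜 (M ⧸ N) where
  proj i := QuotientAddGroup.map N.toAddSubgroup N.toAddSubgroup (G.proj i) (hN i)
  finite x := by
    obtain ⟨y, rfl⟩ := Submodule.mkQ_surjective N x
    refine (G.finite y).subset fun i hi h => hi ?_
    change Submodule.Quotient.mk (G.proj i y) = (0 : M ⧸ N)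
    rw [h, Submodule.Quotient.mk_zero]
  mem_of_forall_mem x L h := by
    obtain ⟨y, rfl⟩ := Submodule.mkQ_surjective N x
    exact G.mem_of_forall_mem y (L.comap N.mkQ.toAddMonoidHom) h
  proj_smul ha j x := by
    obtain ⟨y, rfl⟩ := Submodule.mkQ_surjective N x
    exact congrArg (Submodule.Quotient.mk (p := N)) (G.proj_smul ha j y)

omit [GradedRing 𝒜] in
theorem proj_eq_smul_proj {i : ℤ} {a : R} (ha : a ∈ 𝒜 i) (j : ℤ) (x : M) :
    G.proj j (a • x) = a • G.proj (j - i) x := by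
  rw [← G.proj_smul ha, add_sub_cancel]

/-- The grading of `M / xM` for a homogeneous element `x`. -/
def quotSMulTop {d : ℤ} {x : R} (hx : x ∈ 𝒜 d) : ModuleGrading 𝒜 (QuotSMulTop x M) :=
  G.quotient (x • ⊤) fun i y hy => by
    obtain ⟨z, -, rfl⟩ := (Submodule.mem_smul_pointwise_iff_exists y x ⊤).mp hy
    rw [G.proj_eq_smul_proj hx]
    exact Submodule.smul_mem_pointwise_smul _ x ⊤ trivial

include G in
/-- The associated primes of a graded module are homogeneous. -/
theorem isHomogeneous_of_mem_associatedPrimes [IsNoetherianRing R] {p : Ideal R}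
    (hp : p ∈ associatedPrimes R M) : p.IsHomogeneous 𝒜 := by
  classical
  obtain ⟨hprime, hex⟩ := mem_associatedPrimes_iff.mp hp
  -- Among elements with annihilator p, x has the fewest nonzero components. The leading component b
  -- of an a ∈ p kills the top component of x; were b outside p, b x would still have annihilator p
  -- but fewer components.
  have hex' : ∃ n, ∃ x : M, (∀ r, r ∈ p ↔ r • x = 0) ∧ (G.finite x).toFinset.card = n :=
    hex.elim fun x hx => ⟨_, x, hx, rfl⟩
  obtain ⟨x, hx, hcard⟩ := Nat.find_spec hex'
  have hx0 : x ≠ 0 := fun h => hprime.one_notMem ((hx 1).mpr (by simp [h]))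
  have hne : (G.finite x).toFinset.Nonempty := by
    by_contra hcon
    refine hx0 (G.eq_zero_of_forall fun i => ?_)
    by_contra hi
    exact hcon ⟨i, (G.finite x).mem_toFinset.mpr hi⟩
  set t := (G.finite x).toFinset.max' hne with ht
  have htmem : G.proj t x ≠ 0 := (G.finite x).mem_toFinset.mp (Finset.max'_mem _ hne)
  have htmax : ∀ j, t < j → G.proj j x = 0 := fun j hj => by
    by_contra h
    exact hj.not_ge (Finset.le_max' _ j ((G.finite x).mem_toFinset.mpr h))
  -- the leading component of an element of `p` lies in `p`
  have key : ∀ (s : ℤ) (a : R), a ∈ p → (∀ j, s < j → (decompose 𝒜 a j : R) = 0) →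
      (decompose 𝒜 a s : R) ∈ p := by
    intro s a ha hs
    set b : R := (decompose 𝒜 a s : R) with hb
    have hb𝒜 : b ∈ 𝒜 s := (decompose 𝒜 a s).2
    have hbt : b • G.proj t x = 0 := by
      have h0 : G.proj (s + t) (a • x) = 0 := by rw [(hx a).mp ha, map_zero]
      rw [← sum_support_decompose 𝒜 a, Finset.sum_smul, map_sum] at h0
      rw [Finset.sum_eq_single s] at h0
      · rwa [G.proj_smul hb𝒜] at h0
      · intro j _ hj
        rw [G.proj_eq_smul_proj (decompose 𝒜 a j).2]
        rcases lt_or_gt_of_ne hj with h | h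
        · rw [htmax _ (by omega), smul_zero]
        · rw [hs j h, zero_smul]
      · intro h
        rw [DFinsupp.notMem_support_iff.mp h]
        simp
    by_contra hbp
    have hbx : ∀ r, r ∈ p ↔ r • (b • x) = 0 := fun r => by
      rw [← mul_smul, ← hx]
      exact ⟨fun h => p.mul_mem_right _ h, fun h => (hprime.mem_or_mem h).resolve_right hbp⟩
    refine Nat.find_min hex' ?_ ⟨b • x, hbx, rfl⟩
    rw [← hcard]
    have hsub : (G.finite (b • x)).toFinset ⊆
        ((G.finite x).toFinset.erase t).image fun j => s + j := by
      intro i hi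
      have hi' := (G.finite _).mem_toFinset.mp hi
      rw [Set.mem_ofPred_eq, G.proj_eq_smul_proj hb𝒜] at hi'
      refine Finset.mem_image.mpr ⟨i - s, Finset.mem_erase.mpr ⟨fun h => hi' ?_, ?_⟩, by omega⟩
      · rw [h, hbt]
      · exact (G.finite x).mem_toFinset.mpr fun h => hi' (by rw [h, smul_zero])
    calc _ ≤ _ := Finset.card_le_card hsub
      _ ≤ _ := Finset.card_image_le
      _ < _ := Finset.card_erase_lt_of_mem (Finset.max'_mem _ hne)
  have hall : ∀ (k : ℕ) (s : ℤ) (a : R), a ∈ p →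
      (∀ j, j ≤ s - k ∨ s < j → (decompose 𝒜 a j : R) = 0) → ∀ i, (decompose 𝒜 a i : R) ∈ p := by
    intro k
    induction k with
    | zero =>
      intro s a _ hj i
      rw [hj i (by omega)]
      exact zero_mem _
    | succ k ih =>
      intro s a ha hj i
      have hsp := key s a ha fun j h => hj j (Or.inr h)
      set b : R := (decompose 𝒜 a s : R) with hb
      have hb𝒜 : b ∈ 𝒜 s := (decompose 𝒜 a s).2
      have hcomp : ∀ j, (decompose 𝒜 (a - b) j : R) =
          if j = s then (0 : R) else (decompose 𝒜 a j : R) := by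
        intro j
        rw [decompose_sub, DirectSum.sub_apply, AddSubgroup.coe_sub]
        split_ifs with h
        · rw [h, decompose_of_mem_same 𝒜 hb𝒜, sub_self]
        · rw [decompose_of_mem_ne 𝒜 hb𝒜 (Ne.symm h), sub_zero]
      have := ih (s - 1) (a - b) (p.sub_mem ha hsp) (fun j hj' => by
        rw [hcomp]
        split_ifs with h
        · rfl
        · exact hj j (by omega)) i
      rw [hcomp] at this
      split_ifs at this with h
      · rw [h]; exact hsp
      · exact this
  intro i a ha
  obtain ⟨b, k, hk⟩ := exists_forall_decompose_eq_zero 𝒜 a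
  exact hall (k + 1) (b + k) a ha (fun j hj => hk j (by omega)) i

/-- The radical of the annihilator of `dimSub n` is an intersection of associated primes of M, hence
homogeneous. So at each prime of coheight at least n the submodule is killed by a homogeneous
element outside that prime, and this element also kills components. -/
theorem proj_mem_dimSub [IsNoetherianRing R] [Module.Finite R M] (n : ℕ) (i : ℤ) (x : M)
    (hx : x ∈ dimSub R M n) : G.proj i x ∈ dimSub R M n := by
  intro p hp
  set D := dimSub R M n with hD
  have hJ : (Module.annihilator R D).radical.IsHomogeneous 𝒜 := by
    rw [← Ideal.sInf_minimalPrimes]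
    refine Ideal.IsHomogeneous.sInf fun I hI => G.isHomogeneous_of_mem_associatedPrimes ?_
    exact associatedPrimes.subset_of_injective D.subtype_injective
      (Module.associatedPrimes.minimalPrimes_annihilator_subset_associatedPrimes R D hI)
  have hnle : ¬ (Module.annihilator R D).radical ≤ p.asIdeal := fun hle => by
    have hs : p ∈ Module.support R D := by
      rw [Module.support_eq_zeroLocus]
      exact Ideal.le_radical.trans hle
    exact (supportDim_lt_iff.mp (supportDim_dimSub_lt (M := M) n) p hs).not_ge hp
  obtain ⟨d, r, hrd, ⟨k, hk⟩, hrp⟩ := hJ.exists_notMem_of_not_le hnle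
  refine ⟨r ^ k, fun h => hrp (p.2.mem_of_pow_mem k h), ?_⟩
  have h0 : r ^ k • x = 0 := congrArg Subtype.val (Module.mem_annihilator.mp hk ⟨x, hx⟩)
  rw [← G.proj_smul (SetLike.pow_mem_graded k hrd), h0, map_zero]

/-- The grading of the quotients of the filtration by dimension. -/
def dimQuot [IsNoetherianRing R] [Module.Finite R M] (n : ℕ) : ModuleGrading 𝒜 (DimQuot R M n) :=
  (G.restrict (dimSub R M (n + 1)) fun i x hx => G.proj_mem_dimSub (n + 1) i x hx).quotient _
    fun i x hx => G.proj_mem_dimSub n i x hx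

/-! ### Depth and Cohen-Macaulayness at a prime and at its homogeneous core. -/

section Depth

variable [IsNoetherianRing R] [Module.Finite R M] {q : PrimeSpectrum R}

omit [Module.Finite R M] in
include G in
theorem le_homCore_of_mem_associatedPrimes {p : PrimeSpectrum R}
    (hp : p.asIdeal ∈ associatedPrimes R M) (hpq : p ≤ q) : p ≤ homCore 𝒜 q :=
  le_homCore (G.isHomogeneous_of_mem_associatedPrimes hp) hpq

include G in
theorem homCore_mem_support (hq : q ∈ Module.support R M) : homCore 𝒜 q ∈ Module.support R M := by
  obtain ⟨p, hp, hle⟩ := exists_associatedPrime_le_of_mem_support hq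
  exact Module.mem_support_mono (G.le_homCore_of_mem_associatedPrimes hp hle)
    (mem_support_of_mem_associatedPrimes hp)

-- While the depth at q* is positive, a homogeneous regular x can be divided out, keeping the
-- quotient graded. It is regular at q too, since the associated primes inside q lie inside q*. At
-- the end q, not being homogeneous, is not associated, which yields one more regular element.
include G in
theorem hasDepthAt_succ_of_homCore (hq : homCore 𝒜 q ≠ q) {n : ℕ}
    (h : HasDepthAt (homCore 𝒜 q) n M) : HasDepthAt q (n + 1) M := by
  induction n generalizing M with
  | zero =>
    obtain ⟨x, hx⟩ := exists_isRegularAt (M := M) (q := q) fun hass =>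
      hq (homCore_eq_of_isHomogeneous (G.isHomogeneous_of_mem_associatedPrimes hass))
    refine ⟨x, hx.1, hx.2, ?_⟩
    rw [HasDepthAt, Module.support_quotSMulTop]
    exact ⟨Module.mem_support_mono (homCore_le 𝒜 q) h, by simpa using hx.1⟩
  | succ n ih =>
    have hass : (homCore 𝒜 q).asIdeal ∉ associatedPrimes R M := fun hass => by
      have := h.le_relHeight hass le_rfl
      rw [relHeight_self] at this
      norm_cast at this
    obtain ⟨e, t, he, ht, htI⟩ := exists_degree_ne_zero_notMem_homCore hq
    obtain ⟨d, x, hxd, hxI, hx⟩ := exists_homogeneous_forall_notMem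
      (homCore_isHomogeneous 𝒜 q) he ht htI
      (T := {p ∈ associatedPrimes R M | p ≤ (homCore 𝒜 q).asIdeal})
      ((associatedPrimes.finite R M).subset fun _ h => h.1)
      fun p hp => ⟨hp.1.isPrime, G.isHomogeneous_of_mem_associatedPrimes hp.1,
        lt_of_le_of_ne hp.2 fun h => hass (h ▸ hp.1)⟩
    have hreg : IsRegularAt M (homCore 𝒜 q) x := ⟨hxI, fun p hp hle => hx p ⟨hp, hle⟩⟩
    refine ⟨x, homCore_le 𝒜 q hxI, fun p hp hle => hx p ⟨hp, ?_⟩,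
      ih (G.quotSMulTop hxd) (h.quotSMulTop hreg)⟩
    exact G.le_homCore_of_mem_associatedPrimes (p := ⟨p, hp.isPrime⟩) hp hle

include G in
theorem isCMAt_succ_of_homCore (hq : homCore 𝒜 q ≠ q) {n : ℕ}
    (h : IsCMAt M (homCore 𝒜 q) n) : IsCMAt M q (n + 1) := by
  refine ⟨G.hasDepthAt_succ_of_homCore hq h.1, fun p hp hpq => ?_⟩
  obtain ⟨p₀, hp₀, hle⟩ := exists_associatedPrime_le_of_mem_support hp
  calc relHeight p q ≤ relHeight p₀ q := relHeight_mono hle le_rfl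
    _ ≤ relHeight p₀ (homCore 𝒜 q) + 1 :=
      relHeight_le_relHeight_homCore_add_one (G.isHomogeneous_of_mem_associatedPrimes hp₀)
    _ ≤ ((n + 1 : ℕ) : ℕ∞) := by
      push_cast
      gcongr
      exact h.2 p₀ (mem_support_of_mem_associatedPrimes hp₀)
        (G.le_homCore_of_mem_associatedPrimes hp₀ (hle.trans hpq))

end Depth

end ModuleGrading

end GradedModules

/-! ### H-local rings -/

section HLocalRing

variable {R : Type*} [CommRing R] [IsNoetherianRing R] (𝒜 : ℤ → AddSubgroup R) [GradedRing 𝒜]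
  [IsHLocalRing 𝒜]

/-- The H-maximal ideal as a point of the prime spectrum. -/
noncomputable def hClosedPoint : PrimeSpectrum R := ⟨hMaximalIdeal 𝒜, inferInstance⟩

/-- The difference between the dimension of a graded module and that of its localization at the
H-maximal ideal. -/
noncomputable def hDefect : ℕ := open Classical in if (hMaximalIdeal 𝒜).IsMaximal then 0 else 1

variable {𝒜}

theorem le_hMaximalIdeal {I : Ideal R} (hI : I.IsHomogeneous 𝒜) (hne : I ≠ ⊤) :
    I ≤ hMaximalIdeal 𝒜 := by
  obtain ⟨J, ⟨hJh, hIJ, hJne⟩, hmax⟩ := WellFounded.has_min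
    (wellFounded_gt (α := Ideal R)) {J | J.IsHomogeneous 𝒜 ∧ I ≤ J ∧ J ≠ ⊤} ⟨I, hI, le_rfl, hne⟩
  have hJ : IsHMaximal 𝒜 J := ⟨hJh, hJne, fun K hK hlt => by
    by_contra hKne
    exact hmax K ⟨hK, hIJ.trans hlt.le, hKne⟩ hlt⟩
  rwa [← (IsHLocalRing.existsUnique_isHMaximal (𝒜 := 𝒜)).unique hJ
    (hMaximalIdeal_isHMaximal 𝒜)]

theorem le_hClosedPoint {p : PrimeSpectrum R} (hp : p.asIdeal.IsHomogeneous 𝒜) :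
    p ≤ hClosedPoint 𝒜 :=
  le_hMaximalIdeal hp p.2.ne_top

omit [IsNoetherianRing R] in
theorem isMax_hClosedPoint_iff :
    IsMax (hClosedPoint 𝒜) ↔ (hMaximalIdeal 𝒜).IsMaximal :=
  PrimeSpectrum.isMax_iff

/-- A chain from p ends at some m with m* ⊆ P, and ht(m/p) exceeds ht(m*/p) by at most one. If m* ≠
P, the step from m* to P absorbs this; if m* = P ≠ m, then P is not maximal and the defect is 1. -/
theorem coheight_eq_relHeight_hClosedPoint_add {p : PrimeSpectrum R}
    (hp : p.asIdeal.IsHomogeneous 𝒜) :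
    Order.coheight p = relHeight p (hClosedPoint 𝒜) + hDefect 𝒜 := by
  have hpP := le_hClosedPoint hp
  apply le_antisymm
  · refine Order.coheight_le fun s hs => ?_
    set m := s.last with hm
    have hpm : p ≤ m := hs ▸ LTSeries.monotone s (Fin.zero_le _)
    have hsm : (s.length : ℕ∞) ≤ relHeight p m := length_le_relHeight hs.ge le_rfl
    refine hsm.trans ?_
    have hmP : homCore 𝒜 m ≤ hClosedPoint 𝒜 := le_hClosedPoint (homCore_isHomogeneous 𝒜 m)
    by_cases hmh : homCore 𝒜 m = m
    · exact (relHeight_mono le_rfl (hmh ▸ hmP)).trans le_self_add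
    · refine (relHeight_le_relHeight_homCore_add_one hp).trans ?_
      rcases hmP.lt_or_eq with hlt | heq
      · exact (relHeight_add_one_le_of_lt_right (le_homCore hp hpm) hlt).trans le_self_add
      · have hnm : ¬ (hMaximalIdeal 𝒜).IsMaximal := fun h => by
          have h1 : hClosedPoint 𝒜 ≤ m := heq ▸ homCore_le 𝒜 m
          exact hmh (heq.trans (le_antisymm h1 (isMax_hClosedPoint_iff.mpr h h1)))
        rw [heq, hDefect, if_neg hnm, Nat.cast_one]
  · refine le_trans ?_ (relHeight_add_coheight_le hpP)
    gcongr
    by_cases h : (hMaximalIdeal 𝒜).IsMaximal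
    · simp [hDefect, h]
    · rw [hDefect, if_neg h, Nat.cast_one, Order.one_le_iff_ne_zero, Order.coheight_ne_zero,
        isMax_hClosedPoint_iff]
      exact h

/-- For a maximal m in the support, m* is in the support and inside P, so the condition descends
from P to m* and then climbs to m. -/
theorem ModuleGrading.isCohenMacaulayModule_iff {M : Type*} [AddCommGroup M] [Module R M]
    [Module.Finite R M] (G : ModuleGrading 𝒜 M) : IsCohenMacaulayModule R M ↔
      (hClosedPoint 𝒜 ∈ Module.support R M → ∃ n, IsCMAt M (hClosedPoint 𝒜) n) := by
  refine ⟨fun h hP => h.exists_isCMAt hP, fun h => ?_⟩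
  rw [_root_.isCohenMacaulayModule_iff]
  intro m hm _
  have hm' := G.homCore_mem_support hm
  have hle : homCore 𝒜 m ≤ hClosedPoint 𝒜 := le_hClosedPoint (homCore_isHomogeneous 𝒜 m)
  obtain ⟨n, hn⟩ := h (Module.mem_support_mono hle hm')
  obtain ⟨k, hk, -⟩ := hn.localize hle hm'
  by_cases hmh : homCore 𝒜 m = m
  · exact ⟨k, hmh ▸ hk⟩
  · exact ⟨k + 1, G.isCMAt_succ_of_homCore hmh hk⟩

theorem ModuleGrading.exists_supportDim_lt {M : Type*} [AddCommGroup M] [Module R M]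
    [Module.Finite R M] (G : ModuleGrading 𝒜 M) : ∃ N : ℕ, Module.supportDim R M < N := by
  obtain ⟨H, hH⟩ := ENat.ne_top_iff_exists.mp
    (Ideal.height_ne_top (I := (hClosedPoint 𝒜).asIdeal) (hClosedPoint 𝒜).2.ne_top)
  rw [PrimeSpectrum.height_eq_orderHeight] at hH
  refine ⟨H + hDefect 𝒜 + 1, supportDim_lt_iff_associatedPrimes.mpr fun p hp => ?_⟩
  rw [coheight_eq_relHeight_hClosedPoint_add (G.isHomogeneous_of_mem_associatedPrimes hp)]
  have : relHeight p (hClosedPoint 𝒜) + hDefect 𝒜 ≤ (H + hDefect 𝒜 : ℕ) := by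
    push_cast
    gcongr
    exact (relHeight_le_height _ _).trans_eq hH.symm
  exact this.trans_lt (by exact_mod_cast Nat.lt_succ_self _)

/-- If `M` is sequentially Cohen-Macaulay, then the heights of `q` over the associated primes of
`M` differ from their dimensions by a constant. -/
theorem ModuleGrading.exists_relHeight_add_eq {M : Type*} [AddCommGroup M] [Module R M]
    [Module.Finite R M] (G : ModuleGrading 𝒜 M)
    (hCM : ∀ k, IsCohenMacaulayModule R (DimQuot R M k)) (q : PrimeSpectrum R) :
    ∃ c : ℕ, ∀ k, ∀ p : PrimeSpectrum R, p.asIdeal ∈ associatedPrimes R (DimQuot R M k) → p ≤ q →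
      relHeight p q + c = k := by
  have hqP : homCore 𝒜 q ≤ hClosedPoint 𝒜 := le_hClosedPoint (homCore_isHomogeneous 𝒜 q)
  have key : ∀ k, ∀ p : PrimeSpectrum R, p.asIdeal ∈ associatedPrimes R (DimQuot R M k) → p ≤ q →
      relHeight p (homCore 𝒜 q) + relHeight (homCore 𝒜 q) (hClosedPoint 𝒜) + hDefect 𝒜 = k := by
    intro k p hp hpq
    have hph := (G.dimQuot k).isHomogeneous_of_mem_associatedPrimes hp
    have hpq' : p ≤ homCore 𝒜 q := le_homCore hph hpq
    have hs := mem_support_of_mem_associatedPrimes hp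
    obtain ⟨n, hn⟩ := (hCM k).exists_isCMAt (Module.mem_support_mono (hpq'.trans hqP) hs)
    obtain ⟨m, hm, hmn⟩ := hn.localize hqP (Module.mem_support_mono hpq' hs)
    rw [hm.relHeight_eq hp hpq', hmn, ← hn.relHeight_eq hp (hpq'.trans hqP),
      ← coheight_eq_relHeight_hClosedPoint_add hph, coheight_eq_of_mem_associatedPrimes_dimSub hp]
  obtain ⟨a, ha⟩ := ENat.ne_top_iff_exists.mp (relHeight_ne_top (homCore 𝒜 q) (hClosedPoint 𝒜))
  by_cases hq : homCore 𝒜 q = q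
  · refine ⟨a + hDefect 𝒜, fun k p hp hpq => ?_⟩
    have := key k p hp hpq
    rw [← ha, add_assoc, hq] at this
    exact_mod_cast this
  -- Passing from q* to q adds one to the height, so c is a + `hDefect` - 1. This is a natural
  -- number: if q* = P, then P is strictly inside q, not maximal, and the defect is 1.
  · obtain ⟨c, hc⟩ : ∃ c, a + hDefect 𝒜 = 1 + c := by
      refine Nat.exists_eq_add_of_le ?_
      rcases hqP.lt_or_eq with hlt | heq
      · have h1 := relHeight_add_one_le_of_lt_left hlt le_rfl
        rw [relHeight_self, ← ha] at h1
        have : 1 ≤ a := by exact_mod_cast h1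
        omega
      · have hnm : ¬ (hMaximalIdeal 𝒜).IsMaximal := fun h => by
          have h1 : hClosedPoint 𝒜 ≤ q := heq ▸ homCore_le 𝒜 q
          exact hq (heq.trans (le_antisymm h1 (isMax_hClosedPoint_iff.mpr h h1)))
        rw [hDefect, if_neg hnm]
        omega
    refine ⟨c, fun k p hp hpq => ?_⟩
    have := key k p hp hpq
    rw [relHeight_eq_relHeight_homCore_add_one
      ((G.dimQuot k).isHomogeneous_of_mem_associatedPrimes hp) hpq hq, ← this, ← ha, add_assoc,
      add_assoc]
    exact_mod_cast congrArg (fun n : ℕ => relHeight p (homCore 𝒜 q) + (n : ℕ∞)) hc.symm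

end HLocalRing

theorem theorem2p4 {R : Type*} [CommRing R] [IsNoetherianRing R]
    (𝒜 : ℤ → AddSubgroup R) [GradedRing 𝒜] [IsHLocalRing 𝒜]
    {M : Type*} [AddCommGroup M] [Module R M] [Module.Finite R M] [Nontrivial M]
    (ℳ : ℤ → AddSubgroup M) [DirectSum.Decomposition ℳ] [SetLike.GradedSMul 𝒜 ℳ] :
    (IsSequentiallyCM R M ↔
      IsSequentiallyCM (Localization.AtPrime (hMaximalIdeal 𝒜))
        (LocalizedModule (hMaximalIdeal 𝒜).primeCompl M)) ∧
    (IsSequentiallyCM R M → ∀ p ∈ Module.support R M,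
      IsSequentiallyCM (Localization.AtPrime p.asIdeal)
        (LocalizedModule p.asIdeal.primeCompl M)) := by
  let G : ModuleGrading 𝒜 M := .ofDecomposition ℳ
  obtain ⟨N, hN⟩ := G.exists_supportDim_lt
  rw [isSequentiallyCM_iff hN]
  constructor
  -- At P the constant shift is `hDefect`, by the dimension formula for homogeneous primes, without
  -- any Cohen-Macaulay assumption.
  · have hP := isSequentiallyCM_atPrime_iff (hClosedPoint 𝒜)
      (A := Localization.AtPrime (hClosedPoint 𝒜).asIdeal)
      (LocalizedModule.mkLinearMap (hClosedPoint 𝒜).asIdeal.primeCompl M) (c := hDefect 𝒜) hN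
      fun k p hp _ => by
        rw [← coheight_eq_relHeight_hClosedPoint_add
          ((G.dimQuot k).isHomogeneous_of_mem_associatedPrimes hp)]
        exact coheight_eq_of_mem_associatedPrimes_dimSub hp
    exact (forall_congr' fun k => (G.dimQuot k).isCohenMacaulayModule_iff).trans hP.symm
  · intro h q _
    obtain ⟨c, hc⟩ := G.exists_relHeight_add_eq h q
    rw [isSequentiallyCM_atPrime_iff q (LocalizedModule.mkLinearMap q.asIdeal.primeCompl M) hN hc]
    exact fun k hk => (h k).exists_isCMAt hk
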